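/- **Theorem (Average minimum transmit power for semi-orthogonal user selection).** Let $K_s<K$ and $K_s\le M$, let $\sigma>0$, and let $h_1,\dots,h_K\in\mathbb C^M$ be independent random vectors whose entries are i.i.d. circularly symmetric complex Gaussian with mean $0$ and variance $1$ (the channels of $K$ single-antenna users to a base station with $M$ antennas). Semi-orthogonal user selection (SUS) selects users $s_1,\dots,s_{K_s}$ one after the other: $s_i$ is a not yet selected user $k$ for which the norm of the orthogonal projection of $h_k$ on $\operatorname{span}(h_{s_1},\dots,h_{s_{i-1}})^{\perp}$ is largest (ties are broken in any measurable way). Let $$x_i=\bigl\|\operatorname{proj}_{\operatorname{span}(h_{s_1},\dots,h_{s_{i-1}})^\perp}h_{s_i}\bigr\|^2=\|h_{s_i}\|^2\sin^2\theta_{i-1},$$ where $\theta_{i-1}$ is the angle between $h_{s_i}$ and that span ($\theta_0=\pi/2$). For an SINR target $\gamma>0$ let $p_{\min}(\gamma)$ be the minimum instantaneous transmit power, i.e. the infimum of $\sum_{i=1}^{K_s}p_i$ over all unit beamforming vectors $v_1,\dots,v_{K_s}\in\mathbb C^M$ and powers $p_1,\dots,p_{K_s}>0$ for which all selected users reach the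 target, $$\frac{p_i\,|h_{s_i}^\dagger v_i|^2}{\sum_{j>i}p_j\,|h_{s_i}^\dagger v_j|^2+\sigma^2}\ \ge\ \gamma\qquad(i=1,\dots,K_s)$$ (dirty paper coding in the order of selection: a user sees the interference only of the users encoded after it, and the noise variance is $\sigma^2$). Let $F(n,r,K)$ be the law of the $r$-th largest of the squared norms of $K$ independent $n$-dimensional vectors with i.i.d. circularly symmetric complex Gaussian entries of mean $0$ and variance $1$. Then almost surely the infimum $p_{\min}(\gamma)$ is attained for every $\gamma>0$; the random variables $p_{\min}(\gamma)$ and $1/x_i$ are integrable, and so is $1/x$ under $F(M+1-i,i,K)$, for $1\le i\le K_s$. The high-SINR average minimum transmit power is $\sigma^2\gamma\sum_i\mathbb E[1/x_i]$, in the sense that $$\lim_{\gamma\to\infty}\frac{\mathbb E[p_{\min}(\gamma)]}{\gamma}=\sigma^2\sum_{i=1}^{K_s}\mathbb E\Bigl[\frac1{x_i}\Bigr],$$ and for every $\gamma>0$ $$\mathbb E[p_{\min}(\gamma)]\ \le\ \sigma^2\gamma\sum_{i=1}^{K_s}\mathbb E\Bigl[\frac1{x_i}\Bigr]\ \le\ \sigma^2\gamma\sum_{i=1}^{K_s}\mathbb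 E_{x\sim F(M+1-i,\,i,\,K)}\Bigl[\frac1x\Bigr].$$ -/

import Mathlib

open MeasureTheory ProbabilityTheory Filter Topology

noncomputable section

namespace SUSPower

/-- The circularly symmetric complex Gaussian law with mean `0` and variance `1`: real and
imaginary parts are independent real Gaussians with mean `0` and variance `1 / 2`. -/
def complexGaussian : Measure ℂ :=
  ((gaussianReal 0 (1 / 2)).prod (gaussianReal 0 (1 / 2))).map
    Complex.measurableEquivRealProd.symm

/-- The law of a vector in `ℂⁿ` with i.i.d. entries of law `complexGaussian`. -/
def complexGaussianVec (n : ℕ) : Measure (EuclideanSpace ℂ (Fin n)) :=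
  (Measure.pi fun _ : Fin n => complexGaussian).map (WithLp.toLp 2)

/-- The `(r + 1)`-th largest entry of `x` (so `r = 0` gives the maximum). -/
def nthLargest {K : ℕ} (x : Fin K → ℝ) (r : Fin K) : ℝ :=
  x (Tuple.sort x r.rev)

/-- The law of the `(r + 1)`-th largest of the squared norms of `K` independent `n`-dimensional
complex Gaussian vectors. -/
def normSqOrderLaw (n K : ℕ) (r : Fin K) : Measure ℝ :=
  (Measure.pi fun _ : Fin K => complexGaussianVec n).map
    fun g => nthLargest (fun j => ‖g j‖ ^ 2) r

/-- The norm of the projection of `x` on the orthogonal complement of the span of `h j`, `j ∈ T`. -/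
def residualNorm {M : ℕ} {ι : Type*} (h : ι → EuclideanSpace ℂ (Fin M)) (T : Set ι)
    (x : EuclideanSpace ℂ (Fin M)) : ℝ :=
  ‖(Submodule.span ℂ (h '' T))ᗮ.starProjection x‖

/-- `s 0, s 1, …, s (n - 1)` is a possible outcome of semi-orthogonal user selection for the
channels `h`: each user in turn is a not yet selected one whose channel has the largest projection
on the orthogonal complement of the span of the channels selected before (ties are broken in any
way). -/
def IsSUS {M K n : ℕ} (h : Fin K → EuclideanSpace ℂ (Fin M)) (s : Fin n → Fin K) : Prop :=
  ∀ i : Fin n, (∀ j < i, s j ≠ s i) ∧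
    ∀ k : Fin K, (∀ j < i, s j ≠ k) →
      residualNorm h (s '' Set.Iio i) (h k) ≤ residualNorm h (s '' Set.Iio i) (h (s i))

/-- SINR of user `k` for channels `h`, unit beamforming vectors `v`, powers `p` and noise
variance `σ ^ 2`, if dirty paper coding encodes the users in the order `0, 1, …, n - 1`: a user
only sees the interference of the users that are encoded after it. -/
def sinr {M n : ℕ} (h v : Fin n → EuclideanSpace ℂ (Fin M)) (p : Fin n → ℝ) (σ : ℝ)
    (k : Fin n) : ℝ :=
  p k * ‖inner ℂ (h k) (v k)‖ ^ 2 /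
    (∑ j ∈ Finset.Ioi k, p j * ‖inner ℂ (h k) (v j)‖ ^ 2 + σ ^ 2)

/-- The total transmit powers with which all users can reach the SINR target `γ`, by some choice
of beamforming vectors and power allocation. -/
def achievablePowers {M n : ℕ} (h : Fin n → EuclideanSpace ℂ (Fin M)) (σ γ : ℝ) : Set ℝ :=
  {t | ∃ (v : Fin n → EuclideanSpace ℂ (Fin M)) (p : Fin n → ℝ),
    (∀ k, ‖v k‖ = 1) ∧ (∀ k, 0 < p k) ∧ (∀ k, γ ≤ sinr h v p σ k) ∧ t = ∑ k, p k}

/-- The minimum instantaneous transmit power for the SINR target `γ` at all users. -/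
def minTransmitPower {M n : ℕ} (h : Fin n → EuclideanSpace ℂ (Fin M)) (σ γ : ℝ) : ℝ :=
  sInf (achievablePowers h σ γ)

end SUSPower

end

/-! The power problem is deterministic. Zero forcing sends each beam along the part of its channel
orthogonal to the earlier ones; it meets every target with equality at power `σ²γ ∑ 1/xᵢ`, which is
the upper bound. Conversely, an optimal solution has total power `O(γ)`, and dividing the SINR
constraints by `γ` shows that all interference terms are `O(1)`. A beam, of size about `√γ`, is then
nearly orthogonal to the earlier channels and costs almost its zero-forcing power
(`tendsto_minTransmitPower_div`). Dominated convergence, with the zero-forcing bound as majorant,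
carries the limit to expectations.

For the order statistics, the difficulty is that the subspaces depend on the selected channels. Fix
a sequence `u` and integrate over the event that greedy selection returns `u`. The selected vectors
are replaced one by one by standard basis vectors: with the first `l + 1` of them frozen, a unitary
map determined by them rotates all other channels, whose law it preserves (`lintegral_hybrid_succ`).
What remains is greedy selection against a fixed coordinate flag. There the scores at step `i` (from
`0`) are norms of `K` independent Gaussian vectors in dimension `M - i`, and after `i` removals the
best score left is at least the `(i + 1)`-th largest (`nthLargest_le`).

Integrability is delicate only in dimension one, where `1/‖g‖²` has infinite mean. Since `Ks < K`,
the order statistics used are never the minimum, so the inverse is at most some `1/(‖g a‖ ‖g b‖)`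
with `a ≠ b`, a product of independent integrable variables. The comparison passes finiteness on to
`1/xᵢ`, which also forces `xᵢ > 0` almost surely. -/

noncomputable section

namespace SUSPower

/-! ### Deterministic power minimisation for fixed channels -/

section Power

variable {M n : ℕ}

/-- The scaled beamforming vectors `w` (whose squared norms are the powers) reach the SINR target
`γ` at all users. -/
def IsFeasible (g : Fin n → EuclideanSpace ℂ (Fin M)) (σ γ : ℝ)
    (w : Fin n → EuclideanSpace ℂ (Fin M)) : Prop :=
  ∀ k, γ * (∑ j ∈ Finset.Ioi k, ‖inner ℂ (g k) (w j)‖ ^ 2 + σ ^ 2) ≤ ‖inner ℂ (g k) (w k)‖ ^ 2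

/-- All SINR constraints hold strictly. -/
def IsStrictlyFeasible (g : Fin n → EuclideanSpace ℂ (Fin M)) (σ γ : ℝ)
    (w : Fin n → EuclideanSpace ℂ (Fin M)) : Prop :=
  ∀ k, γ * (∑ j ∈ Finset.Ioi k, ‖inner ℂ (g k) (w j)‖ ^ 2 + σ ^ 2) < ‖inner ℂ (g k) (w k)‖ ^ 2

theorem IsFeasible.ne_zero {g w : Fin n → EuclideanSpace ℂ (Fin M)} {σ γ : ℝ} (hσ : 0 < σ)
    (hγ : 0 < γ) (hw : IsFeasible g σ γ w) (k : Fin n) : w k ≠ 0 := by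
  intro h0
  have h := hw k
  rw [h0, inner_zero_right, norm_zero] at h
  have : 0 < γ * (∑ j ∈ Finset.Ioi k, ‖inner ℂ (g k) (w j)‖ ^ 2 + σ ^ 2) := by positivity
  linarith

/-- Absorbing `√(p k)` into the beam turns the problem into closed conditions on one family of
vectors; dividing by the norm goes back, as no feasible beam vanishes. -/
theorem mem_achievablePowers_iff {g : Fin n → EuclideanSpace ℂ (Fin M)} {σ γ : ℝ} (hσ : 0 < σ)
    (hγ : 0 < γ) {t : ℝ} :
    t ∈ achievablePowers g σ γ ↔ ∃ w, IsFeasible g σ γ w ∧ t = ∑ k, ‖w k‖ ^ 2 := by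
  constructor
  · rintro ⟨v, p, hv, hp, hs, rfl⟩
    have hin : ∀ k j, ‖inner ℂ (g k) (((√(p j) : ℝ) : ℂ) • v j)‖ ^ 2 =
        p j * ‖inner ℂ (g k) (v j)‖ ^ 2 := by
      intro k j
      rw [inner_smul_right, norm_mul, mul_pow, Complex.norm_real, Real.norm_eq_abs, sq_abs,
        Real.sq_sqrt (hp j).le]
    refine ⟨fun k => ((√(p k) : ℝ) : ℂ) • v k, fun k => ?_, Finset.sum_congr rfl fun k _ => ?_⟩
    · simp only [hin]
      refine (le_div_iff₀ ?_).1 (hs k)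
      have : ∀ j ∈ Finset.Ioi k, 0 ≤ p j * ‖inner ℂ (g k) (v j)‖ ^ 2 := fun j _ =>
        mul_nonneg (hp j).le (sq_nonneg _)
      have := Finset.sum_nonneg this
      positivity
    · rw [norm_smul, hv, mul_one, Complex.norm_real, Real.norm_eq_abs, sq_abs,
        Real.sq_sqrt (hp k).le]
  · rintro ⟨w, hw, rfl⟩
    have hw0 := hw.ne_zero hσ hγ
    have hn : ∀ k, 0 < ‖w k‖ := fun k => norm_pos_iff.2 (hw0 k)
    have hin : ∀ k j, ‖w j‖ ^ 2 * ‖inner ℂ (g k) (((‖w j‖⁻¹ : ℝ) : ℂ) • w j)‖ ^ 2 =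
        ‖inner ℂ (g k) (w j)‖ ^ 2 := by
      intro k j
      rw [inner_smul_right, norm_mul, mul_pow, Complex.norm_real, Real.norm_eq_abs, sq_abs,
        ← mul_assoc, ← mul_pow, mul_inv_cancel₀ (hn j).ne', one_pow, one_mul]
    refine ⟨fun k => ((‖w k‖⁻¹ : ℝ) : ℂ) • w k, fun k => ‖w k‖ ^ 2, fun k => ?_, fun k => ?_,
      fun k => ?_, rfl⟩
    · rw [norm_smul, Complex.norm_real, norm_inv, norm_norm, inv_mul_cancel₀ (hn k).ne']
    · have := hn k
      positivity
    · simp only [sinr, hin]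
      rw [le_div_iff₀ (by positivity)]
      exact hw k

theorem bddBelow_achievablePowers (g : Fin n → EuclideanSpace ℂ (Fin M)) (σ γ : ℝ) :
    BddBelow (achievablePowers g σ γ) := by
  refine ⟨0, ?_⟩
  rintro t ⟨v, p, -, hp, -, rfl⟩
  exact Finset.sum_nonneg fun k _ => (hp k).le

theorem minTransmitPower_nonneg (g : Fin n → EuclideanSpace ℂ (Fin M)) (σ γ : ℝ) :
    0 ≤ minTransmitPower g σ γ := by
  refine Real.sInf_nonneg ?_
  rintro t ⟨v, p, -, hp, -, rfl⟩
  exact Finset.sum_nonneg fun k _ => (hp k).le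

/-- The minimum transmit power is attained as soon as the SINR target is feasible. -/
theorem isLeast_minTransmitPower {g : Fin n → EuclideanSpace ℂ (Fin M)} {σ γ : ℝ} (hσ : 0 < σ)
    (hγ : 0 < γ) (hne : (achievablePowers g σ γ).Nonempty) :
    IsLeast (achievablePowers g σ γ) (minTransmitPower g σ γ) := by
  obtain ⟨t, ht⟩ := hne
  obtain ⟨w₀, hw₀, rfl⟩ := (mem_achievablePowers_iff hσ hγ).1 ht
  set C := ∑ k, ‖w₀ k‖ ^ 2 with hC
  -- Cutting the feasible set at the power of one known solution makes it compact without changing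
  -- the minimum.
  let S : Set (Fin n → EuclideanSpace ℂ (Fin M)) :=
    {w | IsFeasible g σ γ w ∧ ∑ k, ‖w k‖ ^ 2 ≤ C}
  have hcl : IsClosed S := by
    have hS : S = {w | IsFeasible g σ γ w} ∩ {w | ∑ k, ‖w k‖ ^ 2 ≤ C} := rfl
    rw [hS]
    refine IsClosed.inter ?_ (isClosed_le (by fun_prop) continuous_const)
    simp only [IsFeasible]
    rw [Set.ofPred_forall]
    exact isClosed_iInter fun k => isClosed_le (by fun_prop) (by fun_prop)
  have hbd : Bornology.IsBounded S := by
    refine (Metric.isBounded_closedBall (x := 0) (r := √C)).subset fun w hw => ?_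
    rw [mem_closedBall_zero_iff, pi_norm_le_iff_of_nonneg (Real.sqrt_nonneg _)]
    intro k
    refine Real.le_sqrt_of_sq_le (le_trans ?_ hw.2)
    exact Finset.single_le_sum (f := fun k => ‖w k‖ ^ 2) (fun j _ => sq_nonneg _)
      (Finset.mem_univ k)
  obtain ⟨w₁, hw₁, hmin⟩ := (Metric.isCompact_of_isClosed_isBounded hcl hbd).exists_isMinOn
    ⟨w₀, hw₀, le_refl C⟩ (f := fun w => ∑ k, ‖w k‖ ^ 2) (by fun_prop)
  have hl : IsLeast (achievablePowers g σ γ) (∑ k, ‖w₁ k‖ ^ 2) := by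
    refine ⟨(mem_achievablePowers_iff hσ hγ).2 ⟨w₁, hw₁.1, rfl⟩, fun t ht => ?_⟩
    obtain ⟨w, hw, rfl⟩ := (mem_achievablePowers_iff hσ hγ).1 ht
    rcases le_total (∑ k, ‖w k‖ ^ 2) C with h | h
    · exact hmin ⟨hw, h⟩
    · exact hw₁.2.trans h
  rw [minTransmitPower, hl.csInf_eq]
  exact hl

/-- Scaling all beams by `c > 1` multiplies signal and interference by `c²` but leaves the noise
alone, which gains the slack `γσ²(c² - 1)`. Strict constraints are open in the channels, and this is
what measurability needs. -/
theorem IsFeasible.exists_isStrictlyFeasible {g w : Fin n → EuclideanSpace ℂ (Fin M)} {σ γ t : ℝ}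
    (hσ : 0 < σ) (hγ : 0 < γ) (hw : IsFeasible g σ γ w) (ht : ∑ k, ‖w k‖ ^ 2 < t) :
    ∃ w', IsStrictlyFeasible g σ γ w' ∧ ∑ k, ‖w' k‖ ^ 2 < t := by
  have hlim : Tendsto (fun c : ℝ => c ^ 2 * ∑ k, ‖w k‖ ^ 2) (𝓝[>] 1)
      (𝓝 (1 ^ 2 * ∑ k, ‖w k‖ ^ 2)) :=
    Continuous.tendsto' (by fun_prop) _ _ rfl |>.mono_left nhdsWithin_le_nhds
  rw [one_pow, one_mul] at hlim
  obtain ⟨c, hct, hc⟩ := ((hlim.eventually_lt_const ht).and self_mem_nhdsWithin).exists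
  have hc1 : 1 < c ^ 2 := one_lt_pow₀ hc two_ne_zero
  have hin : ∀ k j, ‖inner ℂ (g k) ((c : ℂ) • w j)‖ ^ 2 = c ^ 2 * ‖inner ℂ (g k) (w j)‖ ^ 2 := by
    intro k j
    rw [inner_smul_right, norm_mul, mul_pow, Complex.norm_real, Real.norm_eq_abs, sq_abs]
  refine ⟨fun k => (c : ℂ) • w k, fun k => ?_, ?_⟩
  · simp only [hin]
    rw [← Finset.mul_sum]
    have h := mul_le_mul_of_nonneg_left (hw k) (sq_nonneg c)
    have : 0 < γ * σ ^ 2 * (c ^ 2 - 1) := by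
      have := sub_pos.2 hc1
      positivity
    nlinarith
  · simp only [norm_smul, mul_pow, Complex.norm_real, Real.norm_eq_abs, sq_abs]
    rwa [← Finset.mul_sum]

theorem isOpen_setOf_exists_isStrictlyFeasible (σ γ : ℝ)
    (Q : (Fin n → EuclideanSpace ℂ (Fin M)) → Prop) :
    IsOpen {g : Fin n → EuclideanSpace ℂ (Fin M) | ∃ w, IsStrictlyFeasible g σ γ w ∧ Q w} := by
  rw [Set.ofPred_exists]
  refine isOpen_iUnion fun w => ?_
  rw [Set.ofPred_and]
  refine IsOpen.inter ?_ isOpen_const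
  simp only [IsStrictlyFeasible]
  rw [Set.ofPred_forall]
  exact isOpen_iInter_of_finite fun k => isOpen_lt (by fun_prop) (by fun_prop)

theorem exists_isFeasible_iff {g : Fin n → EuclideanSpace ℂ (Fin M)} {σ γ t : ℝ}
    (hσ : 0 < σ) (hγ : 0 < γ) :
    (∃ w, IsFeasible g σ γ w ∧ ∑ k, ‖w k‖ ^ 2 < t) ↔
      ∃ w, IsStrictlyFeasible g σ γ w ∧ ∑ k, ‖w k‖ ^ 2 < t :=
  ⟨fun ⟨_, hw, ht⟩ => hw.exists_isStrictlyFeasible hσ hγ ht,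
    fun ⟨w, hw, ht⟩ => ⟨w, fun k => (hw k).le, ht⟩⟩

theorem measurable_minTransmitPower {σ γ : ℝ} (hσ : 0 < σ) (hγ : 0 < γ) :
    Measurable fun g : Fin n → EuclideanSpace ℂ (Fin M) => minTransmitPower g σ γ := by
  refine measurable_of_Iio fun t => ?_
  let A : Set (Fin n → EuclideanSpace ℂ (Fin M)) := {g | ∃ w, IsStrictlyFeasible g σ γ w ∧ True}
  let B : Set (Fin n → EuclideanSpace ℂ (Fin M)) :=
    {g | ∃ w, IsStrictlyFeasible g σ γ w ∧ ∑ k, ‖w k‖ ^ 2 < t}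
  have hA : MeasurableSet A := (isOpen_setOf_exists_isStrictlyFeasible σ γ _).measurableSet
  have hB : MeasurableSet B := (isOpen_setOf_exists_isStrictlyFeasible σ γ _).measurableSet
  have hAmem : ∀ g, (achievablePowers g σ γ).Nonempty ↔ g ∈ A := by
    intro g
    constructor
    · rintro ⟨t', ht'⟩
      obtain ⟨w, hw, -⟩ := (mem_achievablePowers_iff hσ hγ).1 ht'
      obtain ⟨w', hw', -⟩ := hw.exists_isStrictlyFeasible hσ hγ (lt_add_one _)
      exact ⟨w', hw', trivial⟩
    · rintro ⟨w, hw, -⟩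
      exact ⟨_, (mem_achievablePowers_iff hσ hγ).2 ⟨w, fun k => (hw k).le, rfl⟩⟩
  -- Off `A` no power is achievable and the infimum takes its default value `0`.
  have key : (fun g : Fin n → EuclideanSpace ℂ (Fin M) => minTransmitPower g σ γ) ⁻¹' Set.Iio t =
      (A ∩ B) ∪ (Aᶜ ∩ {_g | 0 < t}) := by
    ext g
    simp only [Set.mem_preimage, Set.mem_Iio, Set.mem_union, Set.mem_inter_iff, Set.mem_compl_iff,
      Set.mem_ofPred_eq]
    by_cases hg : g ∈ A
    · have h1 : minTransmitPower g σ γ < t ↔ g ∈ B := by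
        rw [minTransmitPower, csInf_lt_iff (bddBelow_achievablePowers g σ γ) ((hAmem g).2 hg)]
        refine Iff.trans ?_ (exists_isFeasible_iff hσ hγ)
        constructor
        · rintro ⟨t', ht', hlt⟩
          obtain ⟨w, hw, rfl⟩ := (mem_achievablePowers_iff hσ hγ).1 ht'
          exact ⟨w, hw, hlt⟩
        · rintro ⟨w, hw, hlt⟩
          exact ⟨_, (mem_achievablePowers_iff hσ hγ).2 ⟨w, hw, rfl⟩, hlt⟩
      simp [hg, h1]
    · have h1 : achievablePowers g σ γ = ∅ := by
        rw [← Set.not_nonempty_iff_eq_empty, hAmem]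
        exact hg
      simp [hg, minTransmitPower, h1]
  rw [key]
  exact (hA.inter hB).union (hA.compl.inter (MeasurableSet.const _))

theorem inner_starProjection_orthogonal_eq_zero {ι : Type*} {g : ι → EuclideanSpace ℂ (Fin M)}
    {T : Set ι} {j : ι} (hj : j ∈ T) (x : EuclideanSpace ℂ (Fin M)) :
    inner ℂ (g j) ((Submodule.span ℂ (g '' T))ᗮ.starProjection x) = 0 :=
  Submodule.inner_right_of_mem_orthogonal (Submodule.subset_span (Set.mem_image_of_mem g hj))
    (Submodule.starProjection_apply_mem _ x)

theorem inner_self_starProjection_orthogonal {ι : Type*} (g : ι → EuclideanSpace ℂ (Fin M))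
    (T : Set ι) (x : EuclideanSpace ℂ (Fin M)) :
    inner ℂ x ((Submodule.span ℂ (g '' T))ᗮ.starProjection x) =
      ((residualNorm g T x ^ 2 : ℝ) : ℂ) := by
  rw [residualNorm]
  set W := (Submodule.span ℂ (g '' T))ᗮ
  have h := inner_self_eq_norm_sq_to_K (𝕜 := ℂ) (W.starProjection x)
  rw [Submodule.inner_starProjection_left_eq_right,
    Submodule.starProjection_eq_self_iff.2 (Submodule.starProjection_apply_mem W x)] at h
  rw [h]
  push_cast
  rfl

/-- Zero-forcing dirty paper coding reaches the SINR target with the power `γ σ² ∑ 1 / ρᵢ²`. -/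
theorem zeroForcing_mem_achievablePowers {g : Fin n → EuclideanSpace ℂ (Fin M)} {σ γ : ℝ}
    (hσ : 0 < σ) (hγ : 0 < γ) (hg : ∀ i, 0 < residualNorm g (Set.Iio i) (g i)) :
    σ ^ 2 * γ * ∑ i, 1 / residualNorm g (Set.Iio i) (g i) ^ 2 ∈ achievablePowers g σ γ := by
  rw [mem_achievablePowers_iff hσ hγ]
  let r : Fin n → EuclideanSpace ℂ (Fin M) := fun i =>
    (Submodule.span ℂ (g '' Set.Iio i))ᗮ.starProjection (g i)
  have hr : ∀ i, ‖r i‖ = residualNorm g (Set.Iio i) (g i) := fun i => rfl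
  -- Chosen so that the useful signal `c i * ‖r i‖²` equals `√γ σ`, the target for the noise alone;
  -- `r j` is orthogonal to `g k` for `k < j`, so there is no interference.
  let c : Fin n → ℝ := fun i => √γ * σ / ‖r i‖ ^ 2
  have hcn : ∀ i, ‖(c i : ℂ)‖ = c i := by
    intro i
    rw [Complex.norm_real, Real.norm_eq_abs, abs_of_nonneg]
    positivity
  refine ⟨fun i => (c i : ℂ) • r i, fun k => ?_, ?_⟩
  · have h0 : ∀ j ∈ Finset.Ioi k, ‖inner ℂ (g k) ((c j : ℂ) • r j)‖ ^ 2 = 0 := by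
      intro j hj
      rw [inner_smul_right, inner_starProjection_orthogonal_eq_zero
        (Set.mem_Iio.2 (Finset.mem_Ioi.1 hj))]
      simp
    rw [Finset.sum_eq_zero h0, zero_add, inner_smul_right, inner_self_starProjection_orthogonal,
      ← hr, norm_mul, hcn, Complex.norm_real, Real.norm_eq_abs, abs_of_nonneg (by positivity)]
    have : 0 < ‖r k‖ := by rw [hr]; exact hg k
    simp only [c]
    rw [div_mul_cancel₀ _ (by positivity), mul_pow, Real.sq_sqrt hγ.le]
  · rw [Finset.mul_sum]
    refine Finset.sum_congr rfl fun k _ => ?_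
    have : 0 < ‖r k‖ := by rw [hr]; exact hg k
    rw [norm_smul, hcn, ← hr]
    simp only [c]
    field_simp
    rw [Real.sq_sqrt hγ.le]

theorem minTransmitPower_le {g : Fin n → EuclideanSpace ℂ (Fin M)} {σ γ : ℝ}
    (hσ : 0 < σ) (hγ : 0 < γ) (hg : ∀ i, 0 < residualNorm g (Set.Iio i) (g i)) :
    minTransmitPower g σ γ ≤ σ ^ 2 * γ * ∑ i, 1 / residualNorm g (Set.Iio i) (g i) ^ 2 :=
  csInf_le (bddBelow_achievablePowers g σ γ) (zeroForcing_mem_achievablePowers hσ hγ hg)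

/-- The constant depends on `y` and `B` but not on `w`. It therefore serves for the optimal beams at
all `γ` at once. -/
theorem exists_bound_inner_of_mem_span {ι : Type*} (g : ι → EuclideanSpace ℂ (Fin M)) (T : Set ι)
    (B : ℝ) {y : EuclideanSpace ℂ (Fin M)} (hy : y ∈ Submodule.span ℂ (g '' T)) :
    ∃ D : ℝ, ∀ w, (∀ k ∈ T, ‖inner ℂ (g k) w‖ ≤ B) → ‖(inner ℂ y w : ℂ)‖ ≤ D := by
  induction hy using Submodule.span_induction with
  | mem x hx =>
    obtain ⟨k, hk, rfl⟩ := hx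
    exact ⟨B, fun w hw => hw k hk⟩
  | zero => exact ⟨0, fun w _ => by simp⟩
  | add x y _ _ hx hy =>
    obtain ⟨D₁, h₁⟩ := hx
    obtain ⟨D₂, h₂⟩ := hy
    refine ⟨D₁ + D₂, fun w hw => ?_⟩
    rw [inner_add_left]
    exact (norm_add_le _ _).trans (add_le_add (h₁ w hw) (h₂ w hw))
  | smul a x _ hx =>
    obtain ⟨D, h⟩ := hx
    refine ⟨‖a‖ * D, fun w hw => ?_⟩
    rw [inner_smul_left, norm_mul, RCLike.norm_conj]
    exact mul_le_mul_of_nonneg_left (h w hw) (norm_nonneg a)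

/-- At high SINR targets zero forcing is asymptotically optimal: with bounded total power relative
to `γ` the interference stays bounded, so that each beam needs the zero-forcing power. -/
theorem tendsto_minTransmitPower_div {g : Fin n → EuclideanSpace ℂ (Fin M)} {σ : ℝ} (hσ : 0 < σ)
    (hg : ∀ i, 0 < residualNorm g (Set.Iio i) (g i)) :
    Tendsto (fun γ => minTransmitPower g σ γ / γ) atTop
      (𝓝 (σ ^ 2 * ∑ i, 1 / residualNorm g (Set.Iio i) (g i) ^ 2)) := by
  set ρ : Fin n → ℝ := fun i => residualNorm g (Set.Iio i) (g i) with hρ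
  set C := σ ^ 2 * ∑ i, 1 / ρ i ^ 2 with hC
  -- A bound, free of `γ`, on every interference amplitude: `γ |⟨g k, w j⟩|² ≤ |⟨g k, w k⟩|² ≤ ‖g
  -- k‖² C γ` for `k < j`.
  let B : ℝ := √C * ∑ k, ‖g k‖
  let r : Fin n → EuclideanSpace ℂ (Fin M) := fun i =>
    (Submodule.span ℂ (g '' Set.Iio i))ᗮ.starProjection (g i)
  have hmem : ∀ j, g j - r j ∈ Submodule.span ℂ (g '' Set.Iio j) := by
    intro j
    simp only [r]
    rw [Submodule.starProjection_orthogonal_val, sub_sub_cancel]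
    exact Submodule.starProjection_apply_mem _ _
  choose D hD using fun j => exists_bound_inner_of_mem_span g (Set.Iio j) B (hmem j)
  -- From `√γ σ ≤ |⟨g j, w j⟩| ≤ ρ j ‖w j‖ + D j`; the maximum with `0` allows squaring when `γ` is
  -- small.
  let low : ℝ → ℝ := fun γ => ∑ j, (max 0 (σ - D j / √γ) / ρ j) ^ 2
  have hC0 : 0 ≤ C := by positivity
  have hlow : Tendsto low atTop (𝓝 C) := by
    have h1 : ∀ j, Tendsto (fun γ : ℝ => (max 0 (σ - D j / √γ) / ρ j) ^ 2) atTop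
        (𝓝 ((max 0 (σ - 0) / ρ j) ^ 2)) := by
      intro j
      refine Tendsto.pow (Tendsto.div_const (Tendsto.max tendsto_const_nhds
        (Tendsto.sub tendsto_const_nhds ?_)) _) 2
      exact Tendsto.div_atTop tendsto_const_nhds Real.tendsto_sqrt_atTop
    have h2 := tendsto_finsetSum Finset.univ fun j _ => h1 j
    convert h2 using 2
    rw [hC, Finset.mul_sum]
    refine Finset.sum_congr rfl fun j _ => ?_
    rw [sub_zero, max_eq_right hσ.le]
    ring
  refine tendsto_of_tendsto_of_tendsto_of_le_of_le' hlow tendsto_const_nhds ?_ ?_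
  · filter_upwards [eventually_gt_atTop 0] with γ hγ
    have hl := isLeast_minTransmitPower hσ hγ ⟨_, zeroForcing_mem_achievablePowers hσ hγ hg⟩
    obtain ⟨w, hw, hp⟩ := (mem_achievablePowers_iff hσ hγ).1 hl.1
    have hub := minTransmitPower_le hσ hγ hg
    have hub' : ∀ j, ‖w j‖ ^ 2 ≤ C * γ := by
      intro j
      refine le_trans (Finset.single_le_sum (f := fun k => ‖w k‖ ^ 2) (fun j _ => sq_nonneg _)
        (Finset.mem_univ j)) (hp ▸ hub.trans (le_of_eq ?_))
      rw [hC]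
      ring
    have hB : ∀ k j, k < j → ‖inner ℂ (g k) (w j)‖ ≤ B := by
      intro k j hkj
      have h1 : γ * ‖inner ℂ (g k) (w j)‖ ^ 2 ≤ γ * (‖g k‖ ^ 2 * C) := by
        calc γ * ‖inner ℂ (g k) (w j)‖ ^ 2
            ≤ γ * (∑ j ∈ Finset.Ioi k, ‖inner ℂ (g k) (w j)‖ ^ 2 + σ ^ 2) := by
              refine mul_le_mul_of_nonneg_left ?_ hγ.le
              have := Finset.single_le_sum (f := fun j => ‖inner ℂ (g k) (w j)‖ ^ 2)
                (fun j _ => sq_nonneg _) (Finset.mem_Ioi.2 hkj)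
              nlinarith
          _ ≤ ‖inner ℂ (g k) (w k)‖ ^ 2 := hw k
          _ ≤ (‖g k‖ * ‖w k‖) ^ 2 := by
              gcongr
              exact norm_inner_le_norm _ _
          _ ≤ γ * (‖g k‖ ^ 2 * C) := by
              rw [mul_pow]
              nlinarith [hub' k, sq_nonneg ‖g k‖]
      have h2 := le_of_mul_le_mul_left h1 hγ
      have h3 : ‖inner ℂ (g k) (w j)‖ ≤ √C * ‖g k‖ := by
        refine (Real.le_sqrt_of_sq_le h2).trans (le_of_eq ?_)
        rw [mul_comm, Real.sqrt_mul hC0, Real.sqrt_sq (norm_nonneg _)]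
      refine h3.trans (mul_le_mul_of_nonneg_left ?_ (Real.sqrt_nonneg _))
      exact Finset.single_le_sum (f := fun k => ‖g k‖) (fun j _ => norm_nonneg _)
        (Finset.mem_univ k)
    rw [hp, Finset.sum_div]
    refine Finset.sum_le_sum fun j _ => ?_
    have hsγ : 0 < √γ := Real.sqrt_pos.2 hγ
    have hρj : 0 < ρ j := hg j
    have h4 : √γ * σ ≤ ‖inner ℂ (g j) (w j)‖ := by
      refine le_of_sq_le_sq ?_ (norm_nonneg _)
      rw [mul_pow, Real.sq_sqrt hγ.le]
      refine le_trans (mul_le_mul_of_nonneg_left ?_ hγ.le) (hw j)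
      have := Finset.sum_nonneg (s := Finset.Ioi j) fun i _ =>
        sq_nonneg ‖(inner ℂ (g j) (w i) : ℂ)‖
      linarith
    have h5 : ‖inner ℂ (g j) (w j)‖ ≤ ρ j * ‖w j‖ + D j := by
      calc ‖inner ℂ (g j) (w j)‖ = ‖inner ℂ (r j) (w j) + inner ℂ (g j - r j) (w j)‖ := by
            rw [← inner_add_left, add_sub_cancel]
        _ ≤ _ := (norm_add_le _ _).trans (add_le_add (norm_inner_le_norm (r j) (w j))
            (hD j (w j) fun k hk => hB k j hk))
    have h6 : √γ * max 0 (σ - D j / √γ) ≤ ρ j * ‖w j‖ := by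
      rcases max_cases 0 (σ - D j / √γ) with ⟨h, -⟩ | ⟨h, -⟩ <;> rw [h]
      · rw [mul_zero]
        positivity
      · rw [mul_sub, mul_div_cancel₀ _ hsγ.ne']
        linarith
    rw [le_div_iff₀ hγ, div_pow, div_mul_eq_mul_div, div_le_iff₀ (by positivity)]
    calc max 0 (σ - D j / √γ) ^ 2 * γ = (√γ * max 0 (σ - D j / √γ)) ^ 2 := by
          rw [mul_pow, Real.sq_sqrt hγ.le, mul_comm]
      _ ≤ (ρ j * ‖w j‖) ^ 2 := by gcongr
      _ = ‖w j‖ ^ 2 * ρ j ^ 2 := by ring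
  · filter_upwards [eventually_gt_atTop 0] with γ hγ
    rw [div_le_iff₀ hγ]
    refine (minTransmitPower_le hσ hγ hg).trans (le_of_eq ?_)
    rw [hC]
    ring

end Power

/-! ### Gaussian vectors: unitary invariance -/

instance isProbabilityMeasure_complexGaussian : IsProbabilityMeasure complexGaussian := by
  unfold complexGaussian
  exact Measure.isProbabilityMeasure_map (by fun_prop)

instance isProbabilityMeasure_complexGaussianVec (n : ℕ) :
    IsProbabilityMeasure (complexGaussianVec n) := by
  unfold complexGaussianVec
  exact Measure.isProbabilityMeasure_map (by fun_prop)

theorem charFun_complexGaussian (t : ℂ) :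
    charFun complexGaussian t = Complex.exp (-(‖t‖ ^ 2 / 4 : ℝ)) := by
  have h1 : ∀ z : ℂ, Complex.exp ((inner ℝ z t : ℝ) * Complex.I)
      = Complex.exp (t.re * z.re * Complex.I) * Complex.exp (t.im * z.im * Complex.I) := by
    intro z
    rw [← Complex.exp_add]
    congr 1
    simp [Complex.inner]
    ring
  rw [charFun_apply, complexGaussian, integral_map (by fun_prop) (by fun_prop)]
  simp_rw [h1]
  simp only [Complex.measurableEquivRealProd_symm_apply]
  rw [integral_prod_mul (fun a : ℝ => Complex.exp (t.re * a * Complex.I))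
    (fun b : ℝ => Complex.exp (t.im * b * Complex.I)), ← charFun_apply_real, ← charFun_apply_real,
    charFun_gaussianReal, charFun_gaussianReal, ← Complex.exp_add]
  congr 1
  rw [← Complex.normSq_eq_norm_sq, Complex.normSq_apply]
  push_cast
  simp
  ring

/-- Only the norm of `t` enters, which is the source of unitary invariance. -/
theorem charFun_complexGaussianVec (n : ℕ) (t : EuclideanSpace ℂ (Fin n)) :
    charFun (complexGaussianVec n) t = Complex.exp (-(‖t‖ ^ 2 / 4 : ℝ)) := by
  rw [complexGaussianVec, charFun_pi]
  simp_rw [charFun_complexGaussian]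
  rw [← Complex.exp_sum, EuclideanSpace.norm_sq_eq, Finset.sum_div]
  push_cast
  simp

theorem inner_real_eq_re {n : ℕ} (x y : EuclideanSpace ℂ (Fin n)) :
    (inner ℝ x y : ℝ) = (inner ℂ x y : ℂ).re := by
  simp [PiLp.inner_apply, Complex.inner]

/-- The complex Gaussian law is unitarily invariant. -/
theorem map_complexGaussianVec {n : ℕ}
    (U : EuclideanSpace ℂ (Fin n) ≃ₗᵢ[ℂ] EuclideanSpace ℂ (Fin n)) :
    (complexGaussianVec n).map U = complexGaussianVec n := by
  have := Measure.isProbabilityMeasure_map (μ := complexGaussianVec n) (f := U)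
    U.continuous.aemeasurable
  refine Measure.ext_of_charFun (funext fun t => ?_)
  rw [charFun_apply, integral_map U.continuous.aemeasurable (by fun_prop)]
  have h : ∀ x, (inner ℝ (U x) t : ℝ) = inner ℝ x (U.symm t) := by
    intro x
    rw [inner_real_eq_re, inner_real_eq_re, ← U.inner_map_map x, U.apply_symm_apply]
  simp_rw [h]
  rw [← charFun_apply, charFun_complexGaussianVec, charFun_complexGaussianVec, U.symm.norm_map]


/-! ### Gaussian vectors: inverse moments -/

theorem integrable_abs_rpow_mul_exp_neg_sq :
    Integrable fun x : ℝ => |x| ^ (-(1 / 2) : ℝ) * Real.exp (-1 * |x| ^ 2) := by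
  have hpos : IntegrableOn (fun x : ℝ => |x| ^ (-(1 / 2) : ℝ) * Real.exp (-1 * |x| ^ 2))
      (Set.Ioi 0) := by
    refine (integrableOn_rpow_mul_exp_neg_mul_sq (b := 1) one_pos
      (s := -(1 / 2)) (by norm_num)).congr_fun (fun x hx => ?_) measurableSet_Ioi
    simp only [abs_of_pos (Set.mem_Ioi.1 hx)]
  have hneg : IntegrableOn (fun x : ℝ => |x| ^ (-(1 / 2) : ℝ) * Real.exp (-1 * |x| ^ 2))
      (Set.Iic 0) := by
    rw [← Measure.map_neg_eq_self (volume : Measure ℝ)]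
    let m : MeasurableEmbedding fun x : ℝ => -x := (Homeomorph.neg ℝ).measurableEmbedding
    rw [m.integrableOn_map_iff]
    simp_rw [Function.comp_def, abs_neg, Set.neg_preimage, Set.neg_Iic, neg_zero]
    exact Iff.mpr integrableOn_Ici_iff_integrableOn_Ioi hpos
  rw [← integrableOn_univ, ← Set.Iic_union_Ioi (a := (0 : ℝ))]
  exact hneg.union hpos

theorem lintegral_abs_rpow_gaussianReal_ne_top :
    ∫⁻ x, ENNReal.ofReal |x| ^ (-(1 / 2) : ℝ) ∂(gaussianReal 0 (1 / 2)) ≠ ⊤ := by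
  rw [gaussianReal_of_var_ne_zero _ (by norm_num),
    lintegral_withDensity_eq_lintegral_mul _ (measurable_gaussianPDF _ _) (by fun_prop)]
  have h := (integrable_abs_rpow_mul_exp_neg_sq.const_mul (√(2 * Real.pi * (1 / 2)))⁻¹)
  refine ne_of_lt (lt_of_le_of_lt (le_of_eq (lintegral_congr_ae ?_)) h.2)
  -- At `0` the extended power is `⊤` while the real one is `0`.
  have h0 : ∀ᵐ x : ℝ, x ≠ 0 := by simp [ae_iff]
  filter_upwards [h0] with x hx
  rw [Pi.mul_apply, gaussianPDF, ENNReal.ofReal_rpow_of_pos (abs_pos.2 hx),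
    ← ENNReal.ofReal_mul (gaussianPDFReal_nonneg _ _ _), Real.enorm_eq_ofReal (by positivity)]
  congr 1
  simp [gaussianPDFReal]
  ring

/-- Since `|z|` dominates both `|re z|` and `|im z|`, `|z|⁻¹ ≤ |re z|^(-1/2) |im z|^(-1/2)`, and the
two factors are independent with finite mean. -/
theorem lintegral_norm_inv_complexGaussian_ne_top :
    ∫⁻ z, (ENNReal.ofReal ‖z‖)⁻¹ ∂complexGaussian ≠ ⊤ := by
  rw [complexGaussian, lintegral_map (by fun_prop) (by fun_prop)]
  refine ne_of_lt (lt_of_le_of_lt (lintegral_mono (g := fun p : ℝ × ℝ =>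
    ENNReal.ofReal |p.1| ^ (-(1 / 2) : ℝ) * ENNReal.ofReal |p.2| ^ (-(1 / 2) : ℝ))
    fun p => ?_) ?_)
  · have h1 : ENNReal.ofReal |p.1| ≤
        ENNReal.ofReal ‖Complex.measurableEquivRealProd.symm p‖ := by
      exact ENNReal.ofReal_le_ofReal (Complex.abs_re_le_norm
        (Complex.measurableEquivRealProd.symm p))
    have h2 : ENNReal.ofReal |p.2| ≤
        ENNReal.ofReal ‖Complex.measurableEquivRealProd.symm p‖ := by
      exact ENNReal.ofReal_le_ofReal (Complex.abs_im_le_norm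
        (Complex.measurableEquivRealProd.symm p))
    simp only [ENNReal.rpow_neg]
    set c := ENNReal.ofReal ‖Complex.measurableEquivRealProd.symm p‖ with hc
    calc c⁻¹ = (c ^ (1 / 2 : ℝ))⁻¹ * (c ^ (1 / 2 : ℝ))⁻¹ := by
          rw [← ENNReal.mul_inv (Or.inr (by simp [hc])) (Or.inl (by simp [hc])),
            ← ENNReal.rpow_add_of_nonneg _ _ (by norm_num) (by norm_num)]
          norm_num
      _ ≤ _ := by gcongr
  · rw [lintegral_prod_mul (f := fun a : ℝ => ENNReal.ofReal |a| ^ (-(1 / 2) : ℝ))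
      (g := fun a : ℝ => ENNReal.ofReal |a| ^ (-(1 / 2) : ℝ)) (by fun_prop) (by fun_prop)]
    exact ENNReal.mul_lt_top lintegral_abs_rpow_gaussianReal_ne_top.lt_top
      lintegral_abs_rpow_gaussianReal_ne_top.lt_top

/-- Each coordinate of a complex Gaussian vector is a complex Gaussian. -/
theorem map_coord_complexGaussianVec {n : ℕ} (i : Fin n) :
    (complexGaussianVec n).map (fun x => x i) = complexGaussian := by
  rw [complexGaussianVec, Measure.map_map (by fun_prop) (by fun_prop)]
  exact (measurePreserving_eval (fun _ : Fin n => complexGaussian) i).map_eq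

theorem lintegral_norm_inv_complexGaussianVec_ne_top {n : ℕ} (hn : 0 < n) :
    ∫⁻ x, (ENNReal.ofReal ‖x‖)⁻¹ ∂(complexGaussianVec n) ≠ ⊤ := by
  refine ne_of_lt (lt_of_le_of_lt (lintegral_mono (g := fun x =>
    (ENNReal.ofReal ‖x ⟨0, hn⟩‖)⁻¹) fun x => ?_)
    (lt_of_eq_of_lt ?_ lintegral_norm_inv_complexGaussian_ne_top.lt_top))
  · exact ENNReal.inv_le_inv.2 (ENNReal.ofReal_le_ofReal (PiLp.norm_apply_le x _))
  · rw [← map_coord_complexGaussianVec ⟨0, hn⟩, lintegral_map (by fun_prop) (by fun_prop)]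

/-! ### Gaussian vectors: squared norms without atoms, and coordinate projections -/

/-- Adding an independent real random variable to an atomless one gives an atomless one. -/
theorem nullSingletonClass_map_add {Ω : Type*} [MeasurableSpace Ω] {μ : Measure Ω}
    [IsProbabilityMeasure μ] {X Y : Ω → ℝ} (hX : Measurable X) (hY : Measurable Y)
    (hXY : IndepFun X Y μ) (hY0 : NullSingletonClass (μ.map Y)) :
    NullSingletonClass (μ.map (X + Y)) := by
  refine ⟨fun c => ?_⟩
  have h := (indepFun_iff_map_prod_eq_prod_map_map hX.aemeasurable hY.aemeasurable).1 hXY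
  have hm : MeasurableSet {p : ℝ × ℝ | p.1 + p.2 = c} :=
    measurableSet_eq_fun (by fun_prop) (by fun_prop)
  have h2 : (μ.map X).prod (μ.map Y) {p : ℝ × ℝ | p.1 + p.2 = c} = 0 := by
    have := Measure.isProbabilityMeasure_map (μ := μ) hX.aemeasurable
    have := Measure.isProbabilityMeasure_map (μ := μ) hY.aemeasurable
    refine Measure.measure_prod_null_of_ae_null hm (Filter.Eventually.of_forall fun a => ?_)
    have : Prod.mk a ⁻¹' {p : ℝ × ℝ | p.1 + p.2 = c} = {c - a} := by
      ext b
      simp [eq_sub_iff_add_eq']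
    simp only [this, measure_singleton, Pi.zero_apply]
  rw [← h, Measure.map_apply (by fun_prop) hm] at h2
  rw [Measure.map_apply (by fun_prop) (measurableSet_singleton c)]
  exact h2

theorem nullSingletonClass_map_sq_gaussianReal :
    NullSingletonClass ((gaussianReal 0 (1 / 2)).map fun x => x ^ 2) := by
  have := nullSingletonClass_gaussianReal (μ := 0) (v := 1 / 2) (by norm_num)
  refine ⟨fun c => ?_⟩
  rw [Measure.map_apply (by fun_prop) (measurableSet_singleton c)]
  refine Set.Finite.measure_zero (Set.Finite.subset (Set.toFinite {√c, -√c}) fun x hx => ?_) _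
  simp only [Set.mem_preimage, Set.mem_singleton_iff] at hx
  rw [← hx, Real.sqrt_sq_eq_abs]
  rcases abs_choice x with h | h <;> rw [h] <;> simp

theorem nullSingletonClass_map_norm_sq_complexGaussian :
    NullSingletonClass (complexGaussian.map fun z => ‖z‖ ^ 2) := by
  have h : complexGaussian.map (fun z => ‖z‖ ^ 2) =
      ((gaussianReal 0 (1 / 2)).prod (gaussianReal 0 (1 / 2))).map
        ((fun p : ℝ × ℝ => p.1 ^ 2) + fun p : ℝ × ℝ => p.2 ^ 2) := by
    rw [complexGaussian, Measure.map_map (by fun_prop) (by fun_prop)]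
    congr 1
    ext p
    simp only [Function.comp_apply, Pi.add_apply, Complex.measurableEquivRealProd_symm_apply]
    rw [← Complex.normSq_eq_norm_sq, Complex.normSq_apply]
    ring
  rw [h]
  refine nullSingletonClass_map_add (by fun_prop) (by fun_prop)
    (indepFun_prod (X := fun x : ℝ => x ^ 2) (Y := fun x : ℝ => x ^ 2)
      (by fun_prop) (by fun_prop)) ?_
  have h2 : ((gaussianReal 0 (1 / 2)).prod (gaussianReal 0 (1 / 2))).map
      (fun p : ℝ × ℝ => p.2 ^ 2) = (gaussianReal 0 (1 / 2)).map fun x => x ^ 2 := by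
    have h3 := Measure.map_snd_prod (μ := gaussianReal 0 (1 / 2)) (ν := gaussianReal 0 (1 / 2))
    rw [measure_univ, one_smul] at h3
    conv_rhs => rw [← h3, Measure.map_map (by fun_prop) (by fun_prop)]
    rfl
  rw [h2]
  exact nullSingletonClass_map_sq_gaussianReal

/-- One coordinate suffices: its squared modulus is atomless and independent of the rest of the sum.
Ties between scores against the flag are thereby null events. -/
theorem nullSingletonClass_map_norm_sq_complexGaussianVec {n : ℕ} (hn : 0 < n) :
    NullSingletonClass ((complexGaussianVec n).map fun x => ‖x‖ ^ 2) := by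
  let f : Fin n → (Fin n → ℂ) → ℝ := fun i x => ‖x i‖ ^ 2
  have hf : ∀ i, Measurable (f i) := fun i => by fun_prop
  have hind : iIndepFun f (Measure.pi fun _ : Fin n => complexGaussian) :=
    iIndepFun_pi (X := fun _ z => ‖z‖ ^ 2) fun i => by fun_prop
  let i₀ : Fin n := ⟨0, hn⟩
  have h : (complexGaussianVec n).map (fun x => ‖x‖ ^ 2) =
      (Measure.pi fun _ : Fin n => complexGaussian).map
        ((∑ j ∈ Finset.univ.erase i₀, f j) + f i₀) := by
    rw [complexGaussianVec, Measure.map_map (by fun_prop) (by fun_prop)]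
    congr 1
    rw [Finset.sum_erase_add _ _ (Finset.mem_univ _)]
    ext x
    simp [EuclideanSpace.norm_sq_eq, f]
  rw [h]
  refine nullSingletonClass_map_add (by fun_prop) (hf i₀)
    (hind.indepFun_finsetSum_of_notMem hf (by simp)) ?_
  have h2 : (Measure.pi fun _ : Fin n => complexGaussian).map (f i₀) =
      complexGaussian.map fun z => ‖z‖ ^ 2 := by
    conv_rhs => rw [← (measurePreserving_eval (fun _ : Fin n => complexGaussian) i₀).map_eq,
      Measure.map_map (by fun_prop) (by fun_prop)]
    rfl
  rw [h2]
  exact nullSingletonClass_map_norm_sq_complexGaussian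

/-- Dropping the first `i` coordinates of a complex Gaussian vector leaves a complex Gaussian
vector. -/
theorem map_sum_norm_sq_complexGaussianVec (n i : ℕ) :
    (complexGaussianVec n).map (fun x => ∑ m : Fin n with i ≤ m.1, ‖x m‖ ^ 2) =
      (complexGaussianVec (n - i)).map fun x => ‖x‖ ^ 2 := by
  let e : Fin (n - i) → Fin n := fun m => ⟨m + i, by omega⟩
  have he : Function.Injective e := fun a b hab => by
    simp only [e, Fin.mk.injEq] at hab
    exact Fin.ext (by omega)
  have hpi : (Measure.pi fun _ : Fin n => complexGaussian).map (fun x m => x (e m)) =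
      Measure.pi fun _ : Fin (n - i) => complexGaussian := by
    have h1 : iIndepFun (fun (m : Fin n) (x : Fin n → ℂ) => x m)
        (Measure.pi fun _ : Fin n => complexGaussian) :=
      iIndepFun_pi (X := fun _ z => z) fun i => by fun_prop
    have h2 := (h1.precomp he).map_fun_eq_pi_map fun m => (measurable_pi_apply (e m)).aemeasurable
    rw [h2]
    congr 1
    ext1 m
    exact (measurePreserving_eval (fun _ : Fin n => complexGaussian) (e m)).map_eq
  rw [complexGaussianVec, complexGaussianVec, Measure.map_map (by fun_prop) (by fun_prop),
    Measure.map_map (by fun_prop) (by fun_prop), ← hpi,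
    Measure.map_map (by fun_prop) (by fun_prop)]
  congr 1
  ext x
  simp only [Function.comp_apply, EuclideanSpace.norm_sq_eq]
  rw [← Finset.sum_image (f := fun m => ‖x m‖ ^ 2) (s := Finset.univ) (g := e) he.injOn]
  congr 1
  ext m
  simp only [Finset.mem_filter, Finset.mem_univ, true_and, Finset.mem_image, e]
  exact ⟨fun h => ⟨⟨m - i, by omega⟩, Fin.ext (by simp; omega)⟩,
    by rintro ⟨a, rfl⟩; simp⟩

/-! ### Residual norms as distances to spans -/

section Residual

variable {M : ℕ}

/-- The residual norm is the distance to the span. In this form unitary invariance and measurability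
need no formula for the projection. -/
theorem residualNorm_lt_iff {ι : Type*} (g : ι → EuclideanSpace ℂ (Fin M)) (T : Set ι)
    (x : EuclideanSpace ℂ (Fin M)) (t : ℝ) :
    residualNorm g T x < t ↔ ∃ y ∈ Submodule.span ℂ (g '' T), ‖x - y‖ < t := by
  rw [residualNorm]
  set W := Submodule.span ℂ (g '' T)
  constructor
  · intro h
    refine ⟨W.starProjection x, Submodule.starProjection_apply_mem _ _, ?_⟩
    rwa [Submodule.starProjection_orthogonal_val] at h
  · rintro ⟨y, hy, hlt⟩
    have h0 : Wᗮ.starProjection y = 0 :=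
      Submodule.starProjection_orthogonal_apply_eq_zero hy
    have h1 : Wᗮ.starProjection x = Wᗮ.starProjection (x - y) := by rw [map_sub, h0, sub_zero]
    rw [h1]
    exact (Submodule.norm_starProjection_apply_le _ _).trans_lt hlt

theorem residualNorm_nonneg {ι : Type*} (g : ι → EuclideanSpace ℂ (Fin M)) (T : Set ι)
    (x : EuclideanSpace ℂ (Fin M)) : 0 ≤ residualNorm g T x := norm_nonneg _

theorem residualNorm_comp {ι κ : Type*} (g : ι → EuclideanSpace ℂ (Fin M)) (s : κ → ι) (T : Set κ)
    (x : EuclideanSpace ℂ (Fin M)) :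
    residualNorm (fun k => g (s k)) T x = residualNorm g (s '' T) x := by
  have h : (fun k => g (s k)) '' T = g '' (s '' T) := (Set.image_image g s T).symm
  simp only [residualNorm, h]

/-- Residual norms are invariant under unitary maps. -/
theorem residualNorm_map {ι κ : Type*} {g : ι → EuclideanSpace ℂ (Fin M)}
    {g' : κ → EuclideanSpace ℂ (Fin M)} {T : Set ι} {T' : Set κ}
    (U : EuclideanSpace ℂ (Fin M) ≃ₗᵢ[ℂ] EuclideanSpace ℂ (Fin M))
    (h : (Submodule.span ℂ (g '' T)).map U.toLinearEquiv.toLinearMap = Submodule.span ℂ (g' '' T'))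
    (x : EuclideanSpace ℂ (Fin M)) : residualNorm g' T' (U x) = residualNorm g T x := by
  refine eq_of_forall_gt_iff fun t => ?_
  rw [residualNorm_lt_iff, residualNorm_lt_iff, ← h]
  constructor
  · rintro ⟨y, hy, hlt⟩
    obtain ⟨z, hz, rfl⟩ := Submodule.mem_map.1 hy
    refine ⟨z, hz, ?_⟩
    rwa [← U.norm_map, map_sub]
  · rintro ⟨z, hz, hlt⟩
    refine ⟨U z, Submodule.mem_map_of_mem hz, ?_⟩
    rwa [← map_sub, U.norm_map]

/-- For fixed coefficients the condition `‖x - ∑ cᵢ gᵢ‖ < t` is open in the vectors, so each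
sublevel set is a union of open sets, even where the span drops in dimension. -/
theorem measurable_residualNorm {ι : Type*} [Finite ι] (T : Set ι) :
    Measurable fun p : (ι → EuclideanSpace ℂ (Fin M)) × EuclideanSpace ℂ (Fin M) =>
      residualNorm p.1 T p.2 := by
  classical
  have := Fintype.ofFinite ι
  obtain ⟨S, rfl⟩ : ∃ S : Finset ι, T = ↑S := ⟨T.toFinset, (Set.coe_toFinset T).symm⟩
  refine measurable_of_Iio fun t => IsOpen.measurableSet ?_
  have h : (fun p : (ι → EuclideanSpace ℂ (Fin M)) × EuclideanSpace ℂ (Fin M) =>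
      residualNorm p.1 S p.2) ⁻¹' Set.Iio t =
      {p | ∃ c : S → ℂ, ‖p.2 - ∑ i, c i • p.1 i‖ < t} := by
    ext p
    simp only [Set.mem_preimage, Set.mem_Iio, Set.mem_ofPred_eq, residualNorm_lt_iff]
    constructor
    · rintro ⟨y, hy, hlt⟩
      obtain ⟨c, rfl⟩ := (Submodule.mem_span_image_finset_iff_exists_fun ℂ).1 hy
      exact ⟨c, hlt⟩
    · rintro ⟨c, hlt⟩
      exact ⟨_, (Submodule.mem_span_image_finset_iff_exists_fun ℂ).2 ⟨c, rfl⟩, hlt⟩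
  rw [h, Set.ofPred_exists]
  exact isOpen_iUnion fun c => isOpen_lt (by fun_prop) continuous_const

end Residual

/-! ### The standard coordinate flag -/

section Flag

variable {M n : ℕ}

/-- The first `n` standard basis vectors of `ℂᴹ`. -/
def stdVec (hnM : n ≤ M) (j : Fin n) : EuclideanSpace ℂ (Fin M) :=
  EuclideanSpace.single (Fin.castLE hnM j) 1

theorem residualNorm_stdVec_sq (hnM : n ≤ M) (i : Fin n) (x : EuclideanSpace ℂ (Fin M)) :
    residualNorm (stdVec hnM) (Set.Iio i) x ^ 2 = ∑ m : Fin M with i.1 ≤ m.1, ‖x m‖ ^ 2 := by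
  set W := Submodule.span ℂ (stdVec hnM '' Set.Iio i) with hW
  have hlow : ∀ m : Fin M, m.1 < i.1 → (Wᗮ.starProjection x) m = 0 := by
    intro m hm
    have h := inner_starProjection_orthogonal_eq_zero (g := stdVec hnM) (T := Set.Iio i)
      (j := ⟨m, by omega⟩) (Set.mem_Iio.2 (Fin.lt_def.2 hm)) x
    simpa [stdVec, EuclideanSpace.inner_single_left] using h
  have hspan : ∀ y ∈ W, ∀ m : Fin M, i.1 ≤ m.1 → y m = 0 := by
    intro y hy m hm
    induction hy using Submodule.span_induction with
    | mem y hy =>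
      obtain ⟨j, hj, rfl⟩ := hy
      have hj' : j.1 < i.1 := hj
      simp only [stdVec, PiLp.single_apply, ite_eq_right_iff]
      intro h
      have := congrArg Fin.val h
      simp only [Fin.val_castLE] at this
      omega
    | zero => simp
    | add a b _ _ ha hb => simp [ha, hb]
    | smul c a _ ha => simp [ha]
  have hhigh : ∀ m : Fin M, i.1 ≤ m.1 → (Wᗮ.starProjection x) m = x m := by
    intro m hm
    rw [Submodule.starProjection_orthogonal_val, PiLp.sub_apply,
      hspan _ (Submodule.starProjection_apply_mem _ _) m hm, sub_zero]
  rw [residualNorm, EuclideanSpace.norm_sq_eq, Finset.sum_filter]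
  refine Finset.sum_congr rfl fun m _ => ?_
  split_ifs with hm
  · rw [hhigh m hm]
  · rw [hlow m (by omega)]
    simp

/-- A unitary map that fixes the first standard basis vectors and rotates `a` into the span of
these and the next one. -/
theorem exists_rotation (hnM : n ≤ M) (l : Fin n) {a : EuclideanSpace ℂ (Fin M)}
    (ha : a (Fin.castLE hnM l) ≠ 0) :
    ∃ (U : EuclideanSpace ℂ (Fin M) ≃ₗᵢ[ℂ] EuclideanSpace ℂ (Fin M)) (β : ℂ), β ≠ 0 ∧
      (∀ j < l, U (stdVec hnM j) = stdVec hnM j) ∧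
      U a - β • stdVec hnM l ∈ Submodule.span ℂ (stdVec hnM '' Set.Iio l) := by
  set W := Submodule.span ℂ (stdVec hnM '' Set.Iio l) with hW
  set b := Wᗮ.starProjection a with hb
  have hinner : ∀ j < l, inner ℂ (stdVec hnM j) b = 0 := fun j hj =>
    inner_starProjection_orthogonal_eq_zero (Set.mem_Iio.2 hj) a
  have hel : stdVec hnM l ∈ Wᗮ := by
    rw [hW, Submodule.mem_orthogonal]
    intro y hy
    induction hy using Submodule.span_induction with
    | mem y hy =>
      obtain ⟨j, hj, rfl⟩ := hy
      simp only [stdVec, EuclideanSpace.inner_single_left, PiLp.single_apply]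
      have : Fin.castLE hnM l ≠ Fin.castLE hnM j := fun h =>
        (ne_of_lt (Set.mem_Iio.1 hj)) (Fin.castLE_injective hnM h).symm
      simp [this.symm]
    | zero => simp
    | add _ _ _ _ hx hy => rw [inner_add_left, hx, hy, add_zero]
    | smul _ _ _ hx => rw [inner_smul_left, hx, mul_zero]
  have hb0 : b ≠ 0 := by
    intro h0
    have h1 : inner ℂ (stdVec hnM l) b = a (Fin.castLE hnM l) := by
      rw [hb, ← Submodule.inner_starProjection_left_eq_right,
        Submodule.starProjection_eq_self_iff.2 hel]
      simp [stdVec, EuclideanSpace.inner_single_left]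
    rw [h0, inner_zero_right] at h1
    exact ha h1.symm
  have hbn : 0 < ‖b‖ := norm_pos_iff.2 hb0
  -- Only indices up to `l` are extended to an orthonormal basis, so the `else` branch counts at `l`
  -- alone. The coordinate map of that basis is the required unitary.
  let v : Fin M → EuclideanSpace ℂ (Fin M) := fun m =>
    if m.1 < l.1 then EuclideanSpace.single m 1 else ((‖b‖⁻¹ : ℝ) : ℂ) • b
  have hinner' : ∀ m : Fin M, m.1 < l.1 → inner ℂ (EuclideanSpace.single m 1) b = 0 :=
    fun m hm => hinner ⟨m, by omega⟩ hm
  have hv : Orthonormal ℂ ((Set.Iic (Fin.castLE hnM l)).domRestrict v) := by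
    have hle : ∀ m : Set.Iic (Fin.castLE hnM l), (m : Fin M).1 ≤ l.1 := fun m => m.2
    constructor
    · intro m
      simp only [Set.domRestrict_apply, v]
      split_ifs
      · simp
      · rw [norm_smul, Complex.norm_real, norm_inv, norm_norm, inv_mul_cancel₀ hbn.ne']
    · intro m m' hmm
      simp only [Set.domRestrict_apply, v]
      have hne : (m : Fin M) ≠ m' := fun h => hmm (Subtype.ext h)
      have hne' : (m : Fin M).1 ≠ (m' : Fin M).1 := fun h => hne (Fin.ext h)
      have h1 := hle m
      have h2 := hle m'
      split_ifs with h3 h4 h4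
      · simp [EuclideanSpace.inner_single_left, hne]
      · rw [inner_smul_right, hinner' _ h3, mul_zero]
      · rw [inner_smul_left, ← inner_conj_symm, hinner' _ h4]
        simp
      · omega
  obtain ⟨B, hB⟩ := hv.exists_orthonormalBasis_extension_of_card_eq (by simp)
  have hUe : ∀ j < l, B.repr (stdVec hnM j) = stdVec hnM j := by
    intro j hj
    have h1 := hB (Fin.castLE hnM j) (Set.mem_Iic.2 (Fin.le_def.2 (Fin.le_def.1 hj.le)))
    have h2 : v (Fin.castLE hnM j) = stdVec hnM j := if_pos (Fin.lt_def.1 hj)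
    rw [h2] at h1
    rw [← h1, B.repr_self, h1]
    rfl
  refine ⟨B.repr, (‖b‖ : ℂ), by exact_mod_cast hbn.ne', hUe, ?_⟩
  have h1 := hB (Fin.castLE hnM l) (Set.mem_Iic.2 le_rfl)
  have h2 : v (Fin.castLE hnM l) = ((‖b‖⁻¹ : ℝ) : ℂ) • b := if_neg (lt_irrefl _)
  have h3 : (‖b‖ : ℂ) • stdVec hnM l = B.repr b := by
    have : b = (‖b‖ : ℂ) • B (Fin.castLE hnM l) := by
      rw [h1, h2, smul_smul]
      rw [Complex.ofReal_inv, mul_inv_cancel₀ (by exact_mod_cast hbn.ne'), one_smul]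
    conv_rhs => rw [this, map_smul, B.repr_self]
    rfl
  have h4 : a - b ∈ W := by
    rw [hb, Submodule.starProjection_orthogonal_val, sub_sub_cancel]
    exact Submodule.starProjection_apply_mem _ _
  rw [h3, ← map_sub]
  have h5 : W.map B.repr.toLinearEquiv.toLinearMap ≤ W := by
    rw [hW, Submodule.map_span, Submodule.span_le]
    rintro _ ⟨_, ⟨j, hj, rfl⟩, rfl⟩
    have : B.repr (stdVec hnM j) = stdVec hnM j := hUe j hj
    change B.repr (stdVec hnM j) ∈ _
    rw [this]
    exact Submodule.subset_span (Set.mem_image_of_mem _ hj)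
  exact h5 (Submodule.mem_map_of_mem h4)

end Flag

/-! ### Replacing the selected channels by the flag -/

section Hybrid

variable {M K n : ℕ}

/-- `u` selects greedily with respect to the scores `R`: the user `u i` has the largest score
`R i k` of all users `k` that are not selected before. -/
def IsGreedy (R : Fin n → Fin K → ℝ) (u : Fin n → Fin K) : Prop :=
  ∀ i : Fin n, (∀ j < i, u j ≠ u i) ∧ ∀ k : Fin K, (∀ j < i, u j ≠ k) → R i k ≤ R i (u i)

theorem IsGreedy.injective {R : Fin n → Fin K → ℝ} {u : Fin n → Fin K} (h : IsGreedy R u) :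
    Function.Injective u := by
  intro i j hij
  rcases lt_trichotomy i j with hlt | heq | hlt
  · exact absurd hij ((h j).1 i hlt)
  · exact heq
  · exact absurd hij.symm ((h i).1 j hlt)

/-- Scores of users already selected are never compared. This lets the frozen channels escape the
rotation in `hybridNorm_succ`. -/
theorem isGreedy_congr {R R' : Fin n → Fin K → ℝ} {u : Fin n → Fin K}
    (h : ∀ i k, (∀ j < i, u j ≠ k) → R i k = R' i k) : IsGreedy R u ↔ IsGreedy R' u := by
  refine forall_congr' fun i => and_congr_right fun hi => forall_congr' fun k =>
    imp_congr_right fun hk => ?_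
  rw [h i k hk, h i (u i) hi]

/-- The vectors selected by `u`, the first `l` of them replaced by standard basis vectors. -/
def hybridVec (hnM : n ≤ M) (l : ℕ) (u : Fin n → Fin K) (h : Fin K → EuclideanSpace ℂ (Fin M))
    (j : Fin n) : EuclideanSpace ℂ (Fin M) :=
  if j.1 < l then stdVec hnM j else h (u j)

/-- The residual norms with respect to the spans of the hybrid vectors. -/
def hybridNorm (hnM : n ≤ M) (l : ℕ) (u : Fin n → Fin K) (h : Fin K → EuclideanSpace ℂ (Fin M))
    (i : Fin n) (k : Fin K) : ℝ :=
  residualNorm (hybridVec hnM l u h) (Set.Iio i) (h k)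

theorem hybridNorm_zero (hnM : n ≤ M) (u : Fin n → Fin K) (h : Fin K → EuclideanSpace ℂ (Fin M))
    (i : Fin n) (k : Fin K) : hybridNorm hnM 0 u h i k = residualNorm h (u '' Set.Iio i) (h k) := by
  rw [← residualNorm_comp]
  have : hybridVec hnM 0 u h = fun j => h (u j) := funext fun j => if_neg (Nat.not_lt_zero _)
  rw [hybridNorm, this]

theorem hybridNorm_self (hnM : n ≤ M) (u : Fin n → Fin K) (h : Fin K → EuclideanSpace ℂ (Fin M))
    (i : Fin n) (k : Fin K) :
    hybridNorm hnM n u h i k = residualNorm (stdVec hnM) (Set.Iio i) (h k) := by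
  have : hybridVec hnM n u h = stdVec hnM := funext fun j => if_pos j.2
  rw [hybridNorm, this]

theorem measurable_hybridVec (hnM : n ≤ M) (l : ℕ) (u : Fin n → Fin K) :
    Measurable fun h : Fin K → EuclideanSpace ℂ (Fin M) => hybridVec hnM l u h := by
  refine measurable_pi_lambda _ fun j => ?_
  simp only [hybridVec]
  split_ifs
  · exact measurable_const
  · exact measurable_pi_apply (u j)

theorem measurable_hybridNorm (hnM : n ≤ M) (l : ℕ) (u : Fin n → Fin K) (i : Fin n) (k : Fin K) :
    Measurable fun h : Fin K → EuclideanSpace ℂ (Fin M) => hybridNorm hnM l u h i k := by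
  have h1 : Measurable fun h : Fin K → EuclideanSpace ℂ (Fin M) => (hybridVec hnM l u h, h k) :=
    (measurable_hybridVec hnM l u).prodMk (measurable_pi_apply k)
  have h2 := (measurable_residualNorm (Set.Iio i)).comp h1
  exact h2

theorem measurableSet_isGreedy_hybridNorm (hnM : n ≤ M) (l : ℕ) (u : Fin n → Fin K) :
    MeasurableSet {h : Fin K → EuclideanSpace ℂ (Fin M) | IsGreedy (hybridNorm hnM l u h) u} := by
  have hset : {h : Fin K → EuclideanSpace ℂ (Fin M) | IsGreedy (hybridNorm hnM l u h) u} =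
      ⋂ i, ({_h | ∀ j < i, u j ≠ u i} ∩ ⋂ k, {h | (∀ j < i, u j ≠ k) →
        hybridNorm hnM l u h i k ≤ hybridNorm hnM l u h i (u i)}) := by
    ext h
    simp only [Set.mem_iInter, Set.mem_inter_iff, Set.mem_ofPred_eq, IsGreedy]
  rw [hset]
  refine MeasurableSet.iInter fun i => (MeasurableSet.const _).inter
    (MeasurableSet.iInter fun k => ?_)
  by_cases hk : ∀ j < i, u j ≠ k
  · convert measurableSet_le (measurable_hybridNorm hnM l u i k)
      (measurable_hybridNorm hnM l u i (u i)) using 1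
    exact Set.ext fun h => ⟨fun H => H hk, fun H _ => H⟩
  · convert MeasurableSet.univ
    exact Set.eq_univ_of_forall fun h H => absurd H hk

/-- Rotating the vectors that are not among the first `l + 1` selected ones turns the hybrid
residual norms of level `l` into those of level `l + 1`. -/
theorem hybridNorm_succ (hnM : n ≤ M) (l : Fin n) {u : Fin n → Fin K} (hu : Function.Injective u)
    {U : EuclideanSpace ℂ (Fin M) ≃ₗᵢ[ℂ] EuclideanSpace ℂ (Fin M)} {β : ℂ} (hβ : β ≠ 0)
    {h h' : Fin K → EuclideanSpace ℂ (Fin M)}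
    (hUe : ∀ j < l, U (stdVec hnM j) = stdVec hnM j)
    (hUa : U (h (u l)) - β • stdVec hnM l ∈ Submodule.span ℂ (stdVec hnM '' Set.Iio l))
    (h₁ : ∀ k ∈ u '' Set.Iic l, h' k = h k) (h₂ : ∀ k ∉ u '' Set.Iic l, h' k = U (h k))
    (i : Fin n) (k : Fin K) (hk : ∀ j < i, u j ≠ k) :
    hybridNorm hnM l u h i k = hybridNorm hnM (l + 1) u h' i k := by
  -- Up to step `l` both spans are the same piece of the flag, which `U` fixes; hence frozen and
  -- rotated channels alike keep their scores. Later, all frozen users are excluded by `hk`, and `U`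
  -- has to carry one span to the other.
  rcases le_or_gt i l with hil | hil
  · have e₁ : hybridVec hnM l u h '' Set.Iio i = stdVec hnM '' Set.Iio i :=
      Set.image_congr fun j hj => if_pos (Fin.lt_def.1 (lt_of_lt_of_le hj hil))
    have e₂ : hybridVec hnM (l + 1) u h' '' Set.Iio i = stdVec hnM '' Set.Iio i :=
      Set.image_congr fun j hj => if_pos
        (Nat.lt_succ_of_lt (Fin.lt_def.1 (lt_of_lt_of_le hj hil)))
    by_cases hkl : k ∈ u '' Set.Iic l
    · simp only [hybridNorm, residualNorm, e₁, e₂, h₁ k hkl]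
    · rw [hybridNorm, hybridNorm, h₂ k hkl]
      refine (residualNorm_map U ?_ _).symm
      rw [e₁, e₂, Submodule.map_span]
      congr 1
      ext y
      simp only [Set.mem_image, exists_exists_and_eq_and]
      refine exists_congr fun j => and_congr_right fun hj => ?_
      have : U (stdVec hnM j) = stdVec hnM j := hUe j (lt_of_lt_of_le hj hil)
      change U (stdVec hnM j) = y ↔ _
      rw [this]
  · have hkl : k ∉ u '' Set.Iic l := by
      rintro ⟨j, hj, rfl⟩
      exact hk j (lt_of_le_of_lt hj hil) rfl
    rw [hybridNorm, hybridNorm, h₂ k hkl]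
    refine (residualNorm_map U ?_ _).symm
    set S := Submodule.span ℂ (hybridVec hnM l u h '' Set.Iio i) with hS
    set S' := Submodule.span ℂ (hybridVec hnM (l + 1) u h' '' Set.Iio i) with hS'
    have hmem : ∀ j < i, hybridVec hnM l u h j ∈ S := fun j hj =>
      Submodule.subset_span (Set.mem_image_of_mem _ hj)
    have hmem' : ∀ j < i, hybridVec hnM (l + 1) u h' j ∈ S' := fun j hj =>
      Submodule.subset_span (Set.mem_image_of_mem _ hj)
    have hmapU : ∀ y ∈ S, U y ∈ S.map U.toLinearEquiv.toLinearMap := fun y hy =>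
      Submodule.mem_map_of_mem hy
    have v₁ : ∀ j < l, hybridVec hnM l u h j = stdVec hnM j := fun j hj => if_pos hj
    have v₁' : ∀ j ≤ l, hybridVec hnM (l + 1) u h' j = stdVec hnM j := fun j hj =>
      if_pos (Nat.lt_succ_of_le hj)
    have v₂ : ∀ j, l ≤ j → hybridVec hnM l u h j = h (u j) := fun j hj =>
      if_neg (not_lt.2 (Fin.le_def.1 hj))
    have v₂' : ∀ j, l < j → hybridVec hnM (l + 1) u h' j = U (h (u j)) := by
      intro j hj
      have h3 : hybridVec hnM (l + 1) u h' j = h' (u j) :=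
        if_neg (not_lt.2 (Nat.succ_le_of_lt (Fin.lt_def.1 hj)))
      rw [h3]
      refine h₂ _ ?_
      rintro ⟨j', hj', hjj⟩
      exact absurd (hu hjj ▸ hj' : j ≤ l) (not_le.2 hj)
    apply le_antisymm
    · have hW : Submodule.span ℂ (stdVec hnM '' Set.Iio l) ≤ S' := by
        rw [Submodule.span_le]
        rintro _ ⟨j, hj, rfl⟩
        rw [SetLike.mem_coe, ← v₁' j (le_of_lt hj)]
        exact hmem' j (lt_trans hj hil)
      rw [hS, Submodule.map_span, Submodule.span_le]
      rintro _ ⟨_, ⟨j, hj, rfl⟩, rfl⟩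
      change U (hybridVec hnM l u h j) ∈ S'
      rcases lt_trichotomy j l with hjl | rfl | hjl
      · rw [v₁ j hjl, hUe j hjl, ← v₁' j hjl.le]
        exact hmem' j hj
      · rw [v₂ j le_rfl]
        have := S'.add_mem (hW hUa) (S'.smul_mem β (v₁' j le_rfl ▸ hmem' j hj))
        rwa [sub_add_cancel] at this
      · rw [v₂ j hjl.le, ← v₂' j hjl]
        exact hmem' j hj
    · have hW : Submodule.span ℂ (stdVec hnM '' Set.Iio l) ≤
          S.map U.toLinearEquiv.toLinearMap := by
        rw [Submodule.span_le]
        rintro _ ⟨j, hj, rfl⟩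
        rw [SetLike.mem_coe, ← hUe j hj, ← v₁ j hj]
        exact hmapU _ (hmem j (lt_trans hj hil))
      rw [hS', Submodule.span_le]
      rintro _ ⟨j, hj, rfl⟩
      rw [SetLike.mem_coe]
      rcases lt_trichotomy j l with hjl | rfl | hjl
      · rw [v₁' j hjl.le, ← hUe j hjl, ← v₁ j hjl]
        exact hmapU _ (hmem j hj)
      · rw [v₁' j le_rfl]
        -- This inclusion recovers the new basis vector from the image of the selected channel,
        -- hence the need for `β ≠ 0`.
        have h3 := Submodule.sub_mem _ (hmapU _ (v₂ j le_rfl ▸ hmem j hj)) (hW hUa)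
        rw [sub_sub_cancel] at h3
        have h4 := Submodule.smul_mem _ β⁻¹ h3
        rwa [smul_smul, inv_mul_cancel₀ hβ, one_smul] at h4
      · rw [v₂' j hjl, ← v₂ j hjl.le]
        exact hmapU _ (hmem j hj)

theorem ae_coord_ne_zero (m : Fin M) : ∀ᵐ x ∂(complexGaussianVec M), x m ≠ 0 := by
  have h := nullSingletonClass_map_norm_sq_complexGaussian.measure_singleton 0
  rw [← map_coord_complexGaussianVec m, Measure.map_map (by fun_prop) (by fun_prop),
    Measure.map_apply (by fun_prop) (measurableSet_singleton 0)] at h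
  rw [ae_iff]
  convert h using 2
  ext x
  simp

/-- The joint law of the residual norms does not change if the selected vectors are replaced by
standard basis vectors one after the other. -/
theorem lintegral_hybrid_succ (hnM : n ≤ M) (l : Fin n) (u : Fin n → Fin K) (i : Fin n)
    {φ : ℝ → ENNReal} (hφ : Measurable φ) :
    ∫⁻ h, {h | IsGreedy (hybridNorm hnM l u h) u}.indicator
      (fun h => φ (hybridNorm hnM l u h i (u i))) h
      ∂(Measure.pi fun _ : Fin K => complexGaussianVec M) =
    ∫⁻ h, {h | IsGreedy (hybridNorm hnM (l + 1) u h) u}.indicator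
      (fun h => φ (hybridNorm hnM (l + 1) u h i (u i))) h
      ∂(Measure.pi fun _ : Fin K => complexGaussianVec M) := by
  classical
  by_cases hu : Function.Injective u
  swap
  · have h0 : ∀ l', {h : Fin K → EuclideanSpace ℂ (Fin M) | IsGreedy (hybridNorm hnM l' u h) u} = ∅ :=
      fun l' => Set.eq_empty_of_forall_notMem fun h hh => hu hh.injective
    simp [h0]
  let G : ℕ → (Fin K → EuclideanSpace ℂ (Fin M)) → ENNReal := fun l' =>
    {h | IsGreedy (hybridNorm hnM l' u h) u}.indicator
      (fun h => φ (hybridNorm hnM l' u h i (u i)))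
  have hG : ∀ l', Measurable (G l') := fun l' =>
    (hφ.comp (measurable_hybridNorm hnM l' u i (u i))).indicator
      (measurableSet_isGreedy_hybridNorm hnM l' u)
  change ∫⁻ h, G l h ∂_ = ∫⁻ h, G (l + 1) h ∂_
  -- `p` marks the frozen users, the first `l + 1` entries of `u`; Fubini integrates over all other
  -- channels first.
  obtain ⟨p, hp⟩ : ∃ p : Fin K → Prop, ∀ k, p k ↔ k ∈ u '' Set.Iic l := ⟨_, fun _ => Iff.rfl⟩
  let e := MeasurableEquiv.piEquivPiSubtypeProd (fun _ : Fin K => EuclideanSpace ℂ (Fin M)) p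
  have he := (measurePreserving_piEquivPiSubtypeProd (fun _ : Fin K => complexGaussianVec M) p).symm
  rw [← he.lintegral_comp (hG l), ← he.lintegral_comp (hG (l + 1)),
    lintegral_prod (fun z => G l (e.symm z)) ((hG l).comp he.measurable).aemeasurable,
    lintegral_prod (fun z => G (l + 1) (e.symm z)) ((hG (l + 1)).comp he.measurable).aemeasurable]
  have hpl : p (u l) := (hp _).2 ⟨l, Set.mem_Iic.2 le_rfl, rfl⟩
  have hae : ∀ᵐ y ∂(Measure.pi fun _ : Subtype p => complexGaussianVec M),
      (y ⟨u l, hpl⟩) (Fin.castLE hnM l) ≠ 0 :=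
    (measurePreserving_eval (fun _ : Subtype p => complexGaussianVec M)
      ⟨u l, hpl⟩).quasiMeasurePreserving.ae (ae_coord_ne_zero (Fin.castLE hnM l))
  refine lintegral_congr_ae ?_
  filter_upwards [hae] with y hy
  -- `U` depends on the frozen channels `y` only and acts inside the inner integral, so its
  -- dependence on `y` need not be measurable.
  obtain ⟨U, β, hβ, hUe, hUa⟩ := exists_rotation hnM l hy
  have hUm : MeasurePreserving (fun (z : {k // ¬ p k} → EuclideanSpace ℂ (Fin M)) k => U (z k))
      (Measure.pi fun _ => complexGaussianVec M) (Measure.pi fun _ => complexGaussianVec M) :=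
    measurePreserving_pi _ _ fun _ => ⟨U.continuous.measurable, map_complexGaussianVec U⟩
  have hmeas : Measurable fun z : {k // ¬ p k} → EuclideanSpace ℂ (Fin M) =>
      G (l + 1) (e.symm (y, z)) := (hG (l + 1)).comp (e.symm.measurable.comp measurable_prodMk_left)
  change ∫⁻ z, G l (e.symm (y, z)) ∂_ = ∫⁻ z, G (l + 1) (e.symm (y, z)) ∂_
  rw [← hUm.lintegral_comp hmeas]
  refine lintegral_congr fun z => ?_
  have hpos : ∀ (z : {k // ¬ p k} → EuclideanSpace ℂ (Fin M)) k (hk : p k),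
      e.symm (y, z) k = y ⟨k, hk⟩ := fun z k hk => dif_pos hk
  have hneg : ∀ (z : {k // ¬ p k} → EuclideanSpace ℂ (Fin M)) k (hk : ¬ p k),
      e.symm (y, z) k = z ⟨k, hk⟩ := fun z k hk => dif_neg hk
  have key := hybridNorm_succ hnM l hu hβ (h := e.symm (y, z))
    (h' := e.symm (y, fun k => U (z k))) hUe (by rw [hpos z _ hpl]; exact hUa)
    (fun k hk => by rw [hpos _ k ((hp k).2 hk), hpos _ k ((hp k).2 hk)])
    (fun k hk => by rw [hneg _ k (mt (hp k).1 hk), hneg _ k (mt (hp k).1 hk)])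
  have hiff := isGreedy_congr key
  simp only [G, Set.indicator, Set.mem_ofPred_eq, hiff]
  split_ifs with hgr
  · rw [key i (u i) (hgr i).1]
  · rfl

theorem lintegral_hybrid_zero_eq (hnM : n ≤ M) (u : Fin n → Fin K) (i : Fin n)
    {φ : ℝ → ENNReal} (hφ : Measurable φ) :
    ∫⁻ h, {h | IsGreedy (hybridNorm hnM 0 u h) u}.indicator
      (fun h => φ (hybridNorm hnM 0 u h i (u i))) h
      ∂(Measure.pi fun _ : Fin K => complexGaussianVec M) =
    ∫⁻ h, {h | IsGreedy (hybridNorm hnM n u h) u}.indicator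
      (fun h => φ (hybridNorm hnM n u h i (u i))) h
      ∂(Measure.pi fun _ : Fin K => complexGaussianVec M) := by
  suffices H : ∀ l ≤ n, ∫⁻ h, {h | IsGreedy (hybridNorm hnM 0 u h) u}.indicator
      (fun h => φ (hybridNorm hnM 0 u h i (u i))) h
      ∂(Measure.pi fun _ : Fin K => complexGaussianVec M) =
    ∫⁻ h, {h | IsGreedy (hybridNorm hnM l u h) u}.indicator
      (fun h => φ (hybridNorm hnM l u h i (u i))) h
      ∂(Measure.pi fun _ : Fin K => complexGaussianVec M) from H n le_rfl
  intro l hl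
  induction l with
  | zero => rfl
  | succ l ih => exact (ih (by omega)).trans (lintegral_hybrid_succ hnM ⟨l, hl⟩ u i hφ)

end Hybrid

/-! ### Order statistics and their inverse moments -/

section OrderStatistics

variable {K : ℕ}

/-- The sorting permutation takes finitely many values, and each is cut out by inequalities together
with the index rule for ties. -/
theorem measurable_nthLargest (r : Fin K) : Measurable fun x : Fin K → ℝ => nthLargest x r := by
  let m : MeasurableSpace (Equiv.Perm (Fin K)) := ⊤
  have hsort : Measurable fun x : Fin K → ℝ => Tuple.sort x := by
    refine measurable_to_countable' fun τ => ?_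
    have h : (fun x : Fin K → ℝ => Tuple.sort x) ⁻¹' {τ} =
        (⋂ i, ⋂ j, ⋂ _ : i ≤ j, {x | x (τ i) ≤ x (τ j)}) ∩
          ⋂ i, ⋂ j, ⋂ _ : i < j, ({x | x (τ i) = x (τ j)}ᶜ ∪ {_x | τ i < τ j}) := by
      ext x
      rw [Set.mem_preimage, Set.mem_singleton_iff, eq_comm, Tuple.eq_sort_iff]
      simp only [Monotone, Function.comp_apply, Set.mem_inter_iff, Set.mem_iInter,
        Set.mem_ofPred_eq, Set.mem_union, Set.mem_compl_iff, imp_iff_not_or]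
    rw [h]
    refine (MeasurableSet.iInter fun i => MeasurableSet.iInter fun j => MeasurableSet.iInter
      fun _ => measurableSet_le (by fun_prop) (by fun_prop)).inter
      (MeasurableSet.iInter fun i => MeasurableSet.iInter fun j => MeasurableSet.iInter fun _ =>
        (measurableSet_eq_fun (by fun_prop) (by fun_prop)).compl.union (MeasurableSet.const _))
  have heval : Measurable fun p : Equiv.Perm (Fin K) × (Fin K → ℝ) => p.2 (p.1 r.rev) :=
    measurable_from_prod_countable_right fun τ => measurable_pi_apply (τ r.rev)
  exact heval.comp (hsort.prodMk measurable_id)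

/-- After `i` users have been removed, the largest of the remaining scores is at least the
`(i + 1)`-th largest score. -/
theorem nthLargest_le {n : ℕ} (hnK : n ≤ K) (u : Fin n → Fin K) (i : Fin n) (y : Fin K → ℝ)
    (hy : ∀ k, (∀ j < i, u j ≠ k) → y k ≤ y (u i)) : nthLargest y (i.castLE hnK) ≤ y (u i) := by
  classical
  have hcard : ((Finset.Iio i).image u).card <
      ((Finset.Ici (i.castLE hnK).rev).image (Tuple.sort y)).card := by
    -- The top `i + 1` sorted positions cannot all be occupied by the `i` removed users.
    rw [Finset.card_image_of_injective _ (Tuple.sort y).injective, Fin.card_Ici, Fin.val_rev,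
      Fin.val_castLE]
    refine Finset.card_image_le.trans_lt ?_
    rw [Fin.card_Iio]
    omega
  obtain ⟨k, hk, hk'⟩ := Finset.exists_mem_notMem_of_card_lt_card hcard
  obtain ⟨q, hq, rfl⟩ := Finset.mem_image.1 hk
  refine (Tuple.monotone_sort y (Finset.mem_Ici.1 hq)).trans (hy _ fun j hj h => hk' ?_)
  exact Finset.mem_image.2 ⟨j, Finset.mem_Iio.2 hj, h⟩

/-- An order statistic other than the minimum dominates two of the values. -/
theorem exists_pair_le_nthLargest (x : Fin K → ℝ) {r : Fin K} (hr : r.1 + 1 < K) :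
    ∃ a b, a ≠ b ∧ x a ≤ nthLargest x r ∧ x b ≤ nthLargest x r := by
  let q : Fin K := ⟨r.rev.1 - 1, by omega⟩
  have hrev : r.rev.1 = K - (r.1 + 1) := Fin.val_rev r
  have hlt : q < r.rev := by
    rw [Fin.lt_def]
    change r.rev.1 - 1 < r.rev.1
    omega
  exact ⟨Tuple.sort x q, Tuple.sort x r.rev, fun h => hlt.ne ((Tuple.sort x).injective h),
    Tuple.monotone_sort x hlt.le, le_rfl⟩

theorem lintegral_normSqOrderLaw (n K : ℕ) (r : Fin K) :
    ∫⁻ t, (ENNReal.ofReal t)⁻¹ ∂(normSqOrderLaw n K r) =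
      ∫⁻ g, (ENNReal.ofReal (nthLargest (fun j => ‖g j‖ ^ 2) r))⁻¹
        ∂(Measure.pi fun _ : Fin K => complexGaussianVec n) := by
  have hm : Measurable fun g : Fin K → EuclideanSpace ℂ (Fin n) =>
      nthLargest (fun j => ‖g j‖ ^ 2) r :=
    (measurable_nthLargest r).comp
      (measurable_pi_lambda (fun (g : Fin K → EuclideanSpace ℂ (Fin n)) j => ‖g j‖ ^ 2)
        fun j => by fun_prop)
  rw [normSqOrderLaw, lintegral_map (by fun_prop) hm]

/-- The pair dominated by the order statistic depends on the sample, so the bound sums over all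
pairs. By independence each term factors into means of `‖g‖⁻¹`, which are finite already for `n =
1`. -/
theorem lintegral_inv_normSqOrderLaw_ne_top {n : ℕ} (hn : 0 < n) {r : Fin K} (hr : r.1 + 1 < K) :
    ∫⁻ t, (ENNReal.ofReal t)⁻¹ ∂(normSqOrderLaw n K r) ≠ ⊤ := by
  rw [lintegral_normSqOrderLaw]
  let f : Fin K → (Fin K → EuclideanSpace ℂ (Fin n)) → ENNReal := fun a g =>
    (ENNReal.ofReal ‖g a‖)⁻¹
  have hf : ∀ a, Measurable (f a) := fun a => by fun_prop
  have hind : iIndepFun f (Measure.pi fun _ : Fin K => complexGaussianVec n) :=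
    iIndepFun_pi (X := fun _ x => (ENNReal.ofReal ‖x‖)⁻¹) fun _ => by fun_prop
  refine ne_of_lt (lt_of_le_of_lt (lintegral_mono (g := fun g =>
    ∑ p ∈ Finset.univ.offDiag, (f p.1 * f p.2) g) fun g => ?_) ?_)
  · obtain ⟨a, b, hab, ha, hb⟩ := exists_pair_le_nthLargest (fun j => ‖g j‖ ^ 2) hr
    refine le_trans ?_ (Finset.single_le_sum (f := fun p : Fin K × Fin K => (f p.1 * f p.2) g)
      (fun _ _ => zero_le) (show (a, b) ∈ Finset.univ.offDiag by simpa using hab))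
    simp only [Pi.mul_apply, f]
    rw [← ENNReal.mul_inv (Or.inr (by simp)) (Or.inl (by simp)),
      ← ENNReal.ofReal_mul (norm_nonneg _)]
    refine ENNReal.inv_le_inv.2 (ENNReal.ofReal_le_ofReal ?_)
    nlinarith [sq_nonneg (‖g a‖ - ‖g b‖)]
  · rw [lintegral_finsetSum _ fun p _ => (hf p.1).mul (hf p.2)]
    refine ENNReal.sum_lt_top.2 fun p hp => ?_
    rw [lintegral_mul_eq_lintegral_mul_lintegral_of_indepFun (hf p.1) (hf p.2)
      (hind.indepFun (Finset.mem_offDiag.1 hp).2.2)]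
    have hfin : ∀ a, ∫⁻ g, f a g ∂(Measure.pi fun _ : Fin K => complexGaussianVec n) < ⊤ := by
      intro a
      have := (measurePreserving_eval (fun _ : Fin K => complexGaussianVec n) a).lintegral_comp
        (f := fun x => (ENNReal.ofReal ‖x‖)⁻¹) (by fun_prop)
      exact this.trans_lt (lintegral_norm_inv_complexGaussianVec_ne_top hn).lt_top
    exact ENNReal.mul_lt_top (hfin _) (hfin _)

end OrderStatistics

/-! ### Comparison of the selection with order statistics -/

section Selection

variable {M K n : ℕ}

theorem map_residualNorm_stdVec_sq (hnM : n ≤ M) (i : Fin n) :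
    (complexGaussianVec M).map (fun x => residualNorm (stdVec hnM) (Set.Iio i) x ^ 2) =
      (complexGaussianVec (M - i)).map fun x => ‖x‖ ^ 2 := by
  simp only [residualNorm_stdVec_sq]
  exact map_sum_norm_sq_complexGaussianVec M i

theorem measurable_residualNorm_stdVec_sq (hnM : n ≤ M) (i : Fin n) :
    Measurable fun x => residualNorm (stdVec hnM) (Set.Iio i) x ^ 2 := by
  simp only [residualNorm_stdVec_sq]
  fun_prop

theorem ae_residualNorm_stdVec_ne (hnM : n ≤ M) (i : Fin n) {a b : Fin K} (hab : a ≠ b) :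
    ∀ᵐ h ∂(Measure.pi fun _ : Fin K => complexGaussianVec M),
      residualNorm (stdVec hnM) (Set.Iio i) (h a) ≠ residualNorm (stdVec hnM) (Set.Iio i) (h b) := by
  set q : EuclideanSpace ℂ (Fin M) → ℝ := fun x => residualNorm (stdVec hnM) (Set.Iio i) x ^ 2
    with hq
  have hqm : Measurable q := measurable_residualNorm_stdVec_sq hnM i
  have hind : iIndepFun (fun (k : Fin K) (h : Fin K → EuclideanSpace ℂ (Fin M)) => h k)
      (Measure.pi fun _ : Fin K => complexGaussianVec M) :=
    iIndepFun_pi (X := fun _ x => x) fun _ => by fun_prop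
  have hXY := (hind.indepFun hab).comp (φ := fun x => -q x) (ψ := q) hqm.neg hqm
  have hmap : (Measure.pi fun _ : Fin K => complexGaussianVec M).map (q ∘ fun h => h b) =
      (complexGaussianVec M).map q := by
    conv_rhs => rw [← (measurePreserving_eval (fun _ : Fin K => complexGaussianVec M) b).map_eq,
      Measure.map_map hqm (by fun_prop)]
  have hnull := nullSingletonClass_map_add (by fun_prop) (by fun_prop) hXY (by
    rw [hmap, hq, map_residualNorm_stdVec_sq]
    exact nullSingletonClass_map_norm_sq_complexGaussianVec (by omega))
  have h0 := hnull.measure_singleton 0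
  rw [Measure.map_apply (by fun_prop) (measurableSet_singleton 0)] at h0
  rw [ae_iff]
  refine measure_mono_null (fun h hh => ?_) h0
  have hh' : residualNorm (stdVec hnM) (Set.Iio i) (h a) =
    residualNorm (stdVec hnM) (Set.Iio i) (h b) := not_not.1 hh
  simp only [Set.mem_preimage, Pi.add_apply, Function.comp_apply, Set.mem_singleton_iff, hq, hh']
  ring

theorem IsGreedy.eq_of_injective {R : Fin n → Fin K → ℝ} {u v : Fin n → Fin K}
    (hu : IsGreedy R u) (hv : IsGreedy R v) (hR : ∀ i, Function.Injective (R i)) : u = v := by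
  suffices H : ∀ m : ℕ, ∀ i : Fin n, i.1 = m → u i = v i from funext fun i => H i i rfl
  intro m
  induction m using Nat.strong_induction_on with
  | _ m ih =>
    rintro i rfl
    have heq : ∀ j < i, u j = v j := fun j hj => ih j hj j rfl
    refine hR i (le_antisymm ((hv i).2 _ fun j hj => ?_) ((hu i).2 _ fun j hj => ?_))
    · rw [← heq j hj]
      exact (hu i).1 j hj
    · rw [heq j hj]
      exact (hv i).1 j hj

/-- The expected inverse squared residual norm of the greedy selection for a fixed flag is at
most the expected inverse of the corresponding order statistic. -/
theorem sum_lintegral_flag_le (hnM : n ≤ M) (hnK : n ≤ K) (i : Fin n) :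
    ∑ u : Fin n → Fin K, ∫⁻ h, {h | IsGreedy (hybridNorm hnM n u h) u}.indicator
      (fun h => (ENNReal.ofReal (hybridNorm hnM n u h i (u i) ^ 2))⁻¹) h
      ∂(Measure.pi fun _ : Fin K => complexGaussianVec M) ≤
    ∫⁻ t, (ENNReal.ofReal t)⁻¹ ∂(normSqOrderLaw (M - i) K (i.castLE hnK)) := by
  classical
  set q : EuclideanSpace ℂ (Fin M) → ℝ := fun x => residualNorm (stdVec hnM) (Set.Iio i) x ^ 2
    with hq
  have hqm : Measurable q := measurable_residualNorm_stdVec_sq hnM i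
  have hord : Measurable fun y : Fin K → ℝ =>
      (ENNReal.ofReal (nthLargest y (i.castLE hnK)))⁻¹ :=
    (measurable_nthLargest _).ennreal_ofReal.inv
  -- The values `q (h k)` are independent with the law of the squared norm in dimension `M - i`, so
  -- both integrals are taken over the same product law on `Fin K → ℝ`.
  have hF : ∫⁻ t, (ENNReal.ofReal t)⁻¹ ∂(normSqOrderLaw (M - i) K (i.castLE hnK)) =
      ∫⁻ h, (ENNReal.ofReal (nthLargest (fun k => q (h k)) (i.castLE hnK)))⁻¹
        ∂(Measure.pi fun _ : Fin K => complexGaussianVec M) := by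
    have hp₁ := Measure.isProbabilityMeasure_map (μ := complexGaussianVec M) (f := q)
      hqm.aemeasurable
    have hp₂ := Measure.isProbabilityMeasure_map (μ := complexGaussianVec (M - i))
      (f := fun x => ‖x‖ ^ 2) (by fun_prop)
    have h1 := Measure.pi_map_pi (μ := fun _ : Fin K => complexGaussianVec M) (f := fun _ => q)
      fun _ => hqm.aemeasurable
    have h2 := Measure.pi_map_pi (μ := fun _ : Fin K => complexGaussianVec (M - i))
      (f := fun _ x => ‖x‖ ^ 2) fun _ => by fun_prop
    rw [lintegral_normSqOrderLaw,
      ← lintegral_map (f := fun y => (ENNReal.ofReal (nthLargest y (i.castLE hnK)))⁻¹)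
        (g := fun (g : Fin K → EuclideanSpace ℂ (Fin (M - i))) j => ‖g j‖ ^ 2) hord
        (measurable_pi_lambda _ fun j => by fun_prop),
      ← lintegral_map (f := fun y => (ENNReal.ofReal (nthLargest y (i.castLE hnK)))⁻¹)
        (g := fun (h : Fin K → EuclideanSpace ℂ (Fin M)) k => q (h k)) hord
        (measurable_pi_lambda _ fun j => hqm.comp (measurable_pi_apply j)), h1, h2, hq,
      map_residualNorm_stdVec_sq]
  have hmeas : ∀ u : Fin n → Fin K, Measurable ({h : Fin K → EuclideanSpace ℂ (Fin M) |
      IsGreedy (hybridNorm hnM n u h) u}.indicator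
      fun h => (ENNReal.ofReal (hybridNorm hnM n u h i (u i) ^ 2))⁻¹) := fun u =>
    (((measurable_hybridNorm hnM n u i (u i)).pow_const 2).ennreal_ofReal.inv).indicator
      (measurableSet_isGreedy_hybridNorm hnM n u)
  rw [hF, ← lintegral_finsetSum _ fun u _ => hmeas u]
  -- Without ties at most one `u` is greedy for the flag, so the sum over `u` has at most one
  -- nonzero term and does not overcount.
  have hties : ∀ᵐ h ∂(Measure.pi fun _ : Fin K => complexGaussianVec M), ∀ i : Fin n, ∀ a b : Fin K,
      a ≠ b → residualNorm (stdVec hnM) (Set.Iio i) (h a) ≠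
        residualNorm (stdVec hnM) (Set.Iio i) (h b) := by
    rw [ae_all_iff]; intro i
    rw [ae_all_iff]; intro a
    rw [ae_all_iff]; intro b
    by_cases hab : a = b
    · exact Filter.Eventually.of_forall fun _ h => absurd hab h
    · filter_upwards [ae_residualNorm_stdVec_ne hnM i hab] with h hh _ using hh
  refine lintegral_mono_ae ?_
  filter_upwards [hties] with h hh
  have hR : ∀ u, hybridNorm hnM n u h =
      fun i k => residualNorm (stdVec hnM) (Set.Iio i) (h k) := fun u =>
    funext fun i => funext fun k => hybridNorm_self hnM u h i k
  simp only [Set.indicator, Set.mem_ofPred_eq, hR]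
  by_cases hex : ∃ u : Fin n → Fin K,
      IsGreedy (fun i k => residualNorm (stdVec hnM) (Set.Iio i) (h k)) u
  · obtain ⟨u, hu⟩ := hex
    rw [Finset.sum_eq_single u, if_pos hu]
    · refine ENNReal.inv_le_inv.2 (ENNReal.ofReal_le_ofReal ?_)
      refine nthLargest_le hnK u i (fun k => q (h k)) fun k hk => ?_
      exact pow_le_pow_left₀ (residualNorm_nonneg _ _ _) ((hu i).2 k hk) 2
    · intro v _ hvu
      rw [if_neg]
      intro hv
      refine hvu (hv.eq_of_injective hu fun i a b hab => ?_)
      by_contra hne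
      exact hh i a b hne hab
    · exact fun h => absurd (Finset.mem_univ u) h
  · rw [Finset.sum_eq_zero fun u _ => if_neg fun hu => hex ⟨u, hu⟩]
    exact zero_le

/-- The expected inverse squared orthogonalized channel norm of the users selected by SUS is at
most the expected inverse of the corresponding order statistic. -/
theorem lintegral_inv_residualNorm_sq_le {Ω : Type*} [MeasurableSpace Ω] {P : Measure Ω}
    [IsProbabilityMeasure P] (hnM : n ≤ M) (hnK : n ≤ K)
    {h : Fin K → Ω → EuclideanSpace ℂ (Fin M)}
    (h_law : ∀ k, HasLaw (h k) (complexGaussianVec M) P) (h_indep : iIndepFun h P)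
    {s : Ω → Fin n → Fin K} (hs : ∀ᵐ ω ∂P, IsSUS (fun k => h k ω) (s ω)) (i : Fin n) :
    ∫⁻ ω, (ENNReal.ofReal
      (residualNorm (fun k => h k ω) (s ω '' Set.Iio i) (h (s ω i) ω) ^ 2))⁻¹ ∂P ≤
    ∫⁻ t, (ENNReal.ofReal t)⁻¹ ∂(normSqOrderLaw (M - i) K (i.castLE hnK)) := by
  let φ : ℝ → ENNReal := fun r => (ENNReal.ofReal (r ^ 2))⁻¹
  have hφ : Measurable φ := by fun_prop
  let G : (Fin n → Fin K) → (Fin K → EuclideanSpace ℂ (Fin M)) → ENNReal := fun u =>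
    {h | IsGreedy (hybridNorm hnM 0 u h) u}.indicator (fun h => φ (hybridNorm hnM 0 u h i (u i)))
  have hG : ∀ u, Measurable (G u) := fun u =>
    (hφ.comp (measurable_hybridNorm hnM 0 u i (u i))).indicator
      (measurableSet_isGreedy_hybridNorm hnM 0 u)
  have hH : AEMeasurable (fun ω k => h k ω) P := aemeasurable_pi_lambda _ fun k =>
    (h_law k).aemeasurable
  have hmap : P.map (fun ω k => h k ω) = Measure.pi fun _ : Fin K => complexGaussianVec M := by
    rw [h_indep.map_fun_eq_pi_map fun k => (h_law k).aemeasurable]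
    congr 1
    exact funext fun k => (h_law k).map_eq
  refine le_trans ?_ (sum_lintegral_flag_le hnM hnK i)
  calc ∫⁻ ω, (ENNReal.ofReal
      (residualNorm (fun k => h k ω) (s ω '' Set.Iio i) (h (s ω i) ω) ^ 2))⁻¹ ∂P
      -- The term `u = s ω` alone gives the left side. Other sequences may be greedy too if ties
      -- occur, which only enlarges the sum, so the tie-breaking rule plays no role.
      ≤ ∫⁻ ω, ∑ u, G u (fun k => h k ω) ∂P := by
        refine lintegral_mono_ae ?_
        filter_upwards [hs] with ω hω
        refine le_trans ?_ (Finset.single_le_sum (f := fun u => G u fun k => h k ω)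
          (fun _ _ => zero_le) (Finset.mem_univ (s ω)))
        have hgr : IsGreedy (hybridNorm hnM 0 (s ω) fun k => h k ω) (s ω) := by
          refine (isGreedy_congr fun i k _ => hybridNorm_zero hnM _ _ i k).2 hω
        simp only [G]
        rw [Set.indicator_of_mem (show (fun k => h k ω) ∈ _ from hgr), hybridNorm_zero]
    _ = ∫⁻ h, ∑ u, G u h ∂(Measure.pi fun _ : Fin K => complexGaussianVec M) := by
        rw [← hmap, lintegral_map' (Finset.measurable_fun_sum _ fun u _ => hG u).aemeasurable hH]
    _ = ∑ u, ∫⁻ h, G u h ∂(Measure.pi fun _ : Fin K => complexGaussianVec M) :=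
        lintegral_finsetSum _ fun u _ => hG u
    _ ≤ _ := le_of_eq (Finset.sum_congr rfl fun u _ => lintegral_hybrid_zero_eq hnM u i hφ)

end Selection

/-! ### From extended to real expectations, and the main theorem -/

/-- The extended inverse is `⊤` wherever `f ≤ 0`, whereas the real `1 / 0` is `0`. Finiteness of the
extended integral thus forces positivity almost everywhere, and there the two inverses agree. -/
theorem lintegral_inv_ne_top_imp {α : Type*} [MeasurableSpace α] {μ : Measure α} {f : α → ℝ}
    (hf : AEMeasurable f μ) (hfin : ∫⁻ a, (ENNReal.ofReal (f a))⁻¹ ∂μ ≠ ⊤) :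
    (∀ᵐ a ∂μ, 0 < f a) ∧ Integrable (fun a => 1 / f a) μ ∧
      ∫⁻ a, (ENNReal.ofReal (f a))⁻¹ ∂μ = ENNReal.ofReal (∫ a, 1 / f a ∂μ) := by
  have hpos : ∀ᵐ a ∂μ, 0 < f a := by
    filter_upwards [ae_lt_top' hf.ennreal_ofReal.inv hfin] with a ha
    exact ENNReal.ofReal_pos.1 (ENNReal.inv_lt_top.1 ha)
  have heq : ∀ᵐ a ∂μ, (ENNReal.ofReal (f a))⁻¹ = ENNReal.ofReal (1 / f a) := by
    filter_upwards [hpos] with a ha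
    rw [one_div, ENNReal.ofReal_inv_of_pos ha]
  have hnn : 0 ≤ᵐ[μ] fun a => 1 / f a := by
    filter_upwards [hpos] with a ha
    simp only [Pi.zero_apply]
    positivity
  rw [lintegral_congr_ae heq] at hfin ⊢
  have hint : Integrable (fun a => 1 / f a) μ :=
    (lintegral_ofReal_ne_top_iff_integrable (hf.const_div 1).aestronglyMeasurable hnn).1 hfin
  exact ⟨hpos, hint, (ofReal_integral_eq_lintegral_ofReal hint hnn).symm⟩

theorem aemeasurable_comp_selection {Ω α β γ : Type*} [MeasurableSpace Ω] [MeasurableSpace α]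
    [MeasurableSpace β] [MeasurableSpace γ] [Countable α] [MeasurableSingletonClass α]
    {P : Measure Ω} {s : Ω → α} (hs : Measurable s) {H : Ω → β} (hH : AEMeasurable H P)
    {f : α → β → γ} (hf : ∀ a, Measurable (f a)) : AEMeasurable (fun ω => f (s ω) (H ω)) P :=
  (measurable_from_prod_countable_right (f := fun p : α × β => f p.1 p.2) hf).comp_aemeasurable
    (hs.aemeasurable.prodMk hH)

end SUSPower

end

theorem mainTheorem3 {Ω : Type*} [MeasurableSpace Ω] (P : Measure Ω) [IsProbabilityMeasure P]
    (M K Ks : ℕ) (hKsM : Ks ≤ M) (hKsK : Ks < K) (σ : ℝ) (hσ : 0 < σ)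
    (h : Fin K → Ω → EuclideanSpace ℂ (Fin M))
    (h_law : ∀ k, HasLaw (h k) (SUSPower.complexGaussianVec M) P)
    (h_indep : iIndepFun h P)
    (s : Ω → Fin Ks → Fin K) (hs_meas : Measurable s)
    (hs : ∀ᵐ ω ∂P, SUSPower.IsSUS (fun k => h k ω) (s ω)) :
    -- the squared orthogonalized channel norm of the `i`-th selected user
    let x : Fin Ks → Ω → ℝ := fun i ω =>
      SUSPower.residualNorm (fun k => h k ω) (s ω '' Set.Iio i) (h (s ω i) ω) ^ 2
    -- the minimum transmit power for the selected users
    let p : ℝ → Ω → ℝ := fun γ ω =>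
      SUSPower.minTransmitPower (fun i => h (s ω i) ω) σ γ
    -- the law of the `i`-th largest of `K` squared norms in dimension `M + 1 - i`, `i = 1, …, Ks`
    let F : Fin Ks → Measure ℝ := fun i =>
      SUSPower.normSqOrderLaw (M - i) K (i.castLE hKsK.le)
    (∀ᵐ ω ∂P, ∀ γ : ℝ, 0 < γ →
      IsLeast (SUSPower.achievablePowers (fun i => h (s ω i) ω) σ γ) (p γ ω)) ∧
    (∀ i, Integrable (fun ω => 1 / x i ω) P) ∧
    (∀ i, Integrable (fun t : ℝ => 1 / t) (F i)) ∧
    (∀ γ : ℝ, 0 < γ → Integrable (p γ) P) ∧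
    Tendsto (fun γ : ℝ => (∫ ω, p γ ω ∂P) / γ) atTop
      (𝓝 (σ ^ 2 * ∑ i, ∫ ω, 1 / x i ω ∂P)) ∧
    ∀ γ : ℝ, 0 < γ →
      ∫ ω, p γ ω ∂P ≤ σ ^ 2 * γ * ∑ i, ∫ ω, 1 / x i ω ∂P ∧
      σ ^ 2 * γ * ∑ i, ∫ ω, 1 / x i ω ∂P ≤ σ ^ 2 * γ * ∑ i, ∫ t, 1 / t ∂(F i) := by
  intro x p F
  have hH : AEMeasurable (fun ω k => h k ω) P := aemeasurable_pi_lambda _ fun k =>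
    (h_law k).aemeasurable
  have hx_meas : ∀ i, AEMeasurable (x i) P := fun i =>
    SUSPower.aemeasurable_comp_selection hs_meas hH
      (f := fun u g => SUSPower.residualNorm g (u '' Set.Iio i) (g (u i)) ^ 2) fun u =>
        ((SUSPower.measurable_residualNorm (M := M) (u '' Set.Iio i)).comp
          (measurable_id.prodMk (measurable_pi_apply (u i)))).pow_const 2
  have hp_meas : ∀ γ, 0 < γ → AEMeasurable (p γ) P := fun γ hγ =>
    SUSPower.aemeasurable_comp_selection hs_meas hH
      (f := fun u g => SUSPower.minTransmitPower (fun i => g (u i)) σ γ) fun u =>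
        (SUSPower.measurable_minTransmitPower hσ hγ).comp
          (measurable_pi_lambda _ fun i => measurable_pi_apply (u i))
  -- Here `Ks ≤ M` makes the dimension positive and `Ks < K` keeps the order statistic away from the
  -- minimum.
  have hF_fin : ∀ i, ∫⁻ t, (ENNReal.ofReal t)⁻¹ ∂(F i) ≠ ⊤ := fun i =>
    SUSPower.lintegral_inv_normSqOrderLaw_ne_top (by omega) (by
      rw [Fin.val_castLE]
      omega)
  have hle : ∀ i, ∫⁻ ω, (ENNReal.ofReal (x i ω))⁻¹ ∂P ≤ ∫⁻ t, (ENNReal.ofReal t)⁻¹ ∂(F i) :=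
    SUSPower.lintegral_inv_residualNorm_sq_le hKsM hKsK.le h_law h_indep hs
  have hx := fun i => SUSPower.lintegral_inv_ne_top_imp (hx_meas i)
    (ne_top_of_le_ne_top (hF_fin i) (hle i))
  have hF := fun i => SUSPower.lintegral_inv_ne_top_imp (f := fun t : ℝ => t)
    aemeasurable_id (hF_fin i)
  have hcomp : ∀ ω i, SUSPower.residualNorm (fun j => h (s ω j) ω) (Set.Iio i) (h (s ω i) ω) ^ 2 =
      x i ω := fun ω i => by
    rw [SUSPower.residualNorm_comp (fun k => h k ω) (s ω)]
  have hgood : ∀ᵐ ω ∂P, ∀ i,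
      0 < SUSPower.residualNorm (fun j => h (s ω j) ω) (Set.Iio i) (h (s ω i) ω) := by
    filter_upwards [ae_all_iff.2 fun i => (hx i).1] with ω hω i
    have := hω i
    rw [← hcomp] at this
    exact lt_of_le_of_ne (SUSPower.residualNorm_nonneg _ _ _) fun h0 => by simp [← h0] at this
  have hub : ∀ γ : ℝ, 0 < γ → ∀ᵐ ω ∂P, p γ ω ≤ σ ^ 2 * γ * ∑ i, 1 / x i ω := by
    intro γ hγ
    filter_upwards [hgood] with ω hω
    have := SUSPower.minTransmitPower_le hσ hγ hω
    simpa only [hcomp] using this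
  have hp0 : ∀ γ ω, 0 ≤ p γ ω := fun γ ω => SUSPower.minTransmitPower_nonneg _ σ γ
  have hsum : Integrable (fun ω => ∑ i, 1 / x i ω) P :=
    integrable_finsetSum _ fun i _ => (hx i).2.1
  have hsum_int : ∫ ω, ∑ i, 1 / x i ω ∂P = ∑ i, ∫ ω, 1 / x i ω ∂P :=
    integral_finsetSum _ fun i _ => (hx i).2.1
  have hp_int : ∀ γ : ℝ, 0 < γ → Integrable (p γ) P := by
    intro γ hγ
    refine (hsum.const_mul (σ ^ 2 * γ)).mono' (hp_meas γ hγ).aestronglyMeasurable ?_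
    filter_upwards [hub γ hγ] with ω hω
    rwa [Real.norm_of_nonneg (hp0 γ ω)]
  refine ⟨?_, fun i => (hx i).2.1, fun i => (hF i).2.1, hp_int, ?_, fun γ hγ => ⟨?_, ?_⟩⟩
  · filter_upwards [hgood] with ω hω γ hγ
    exact SUSPower.isLeast_minTransmitPower hσ hγ
      ⟨_, SUSPower.zeroForcing_mem_achievablePowers hσ hγ hω⟩
  -- After division by `γ` the zero-forcing bound no longer depends on `γ`, so the pointwise limit
  -- is itself the majorant.
  · have hlim := tendsto_integral_filter_of_dominated_convergence (l := atTop) (μ := P)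
      (F := fun γ ω => p γ ω / γ) (f := fun ω => σ ^ 2 * ∑ i, 1 / x i ω)
      (fun ω => σ ^ 2 * ∑ i, 1 / x i ω) ?_ ?_ (hsum.const_mul _) ?_
    · rw [integral_const_mul, hsum_int] at hlim
      exact hlim.congr fun γ => integral_div γ (p γ)
    · filter_upwards [eventually_gt_atTop 0] with γ hγ
      exact ((hp_meas γ hγ).div_const γ).aestronglyMeasurable
    · filter_upwards [eventually_gt_atTop 0] with γ hγ
      filter_upwards [hub γ hγ] with ω hω
      rw [Real.norm_of_nonneg (div_nonneg (hp0 γ ω) hγ.le), div_le_iff₀ hγ]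
      linarith
    · filter_upwards [hgood] with ω hω
      have := SUSPower.tendsto_minTransmitPower_div hσ hω
      simpa only [hcomp] using this
  · rw [← hsum_int, ← integral_const_mul]
    exact integral_mono_ae (hp_int γ hγ) (hsum.const_mul _) (hub γ hγ)
  · refine mul_le_mul_of_nonneg_left (Finset.sum_le_sum fun i _ => ?_) (by positivity)
    have h1 := hle i
    rw [(hx i).2.2, (hF i).2.2] at h1
    refine (ENNReal.ofReal_le_ofReal_iff (integral_nonneg_of_ae ?_)).1 h1
    filter_upwards [(hF i).1] with t ht
    simp only [Pi.zero_apply]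
    positivity
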